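/- Let $\mu$ be a compactly supported probability measure on $\mathbb{R}$ with $\int x\,d\mu=0$, $\int x^2\,d\mu=\sigma^2$, $\int x^3\,d\mu\neq 0$, and, for some constant $K$, $\int |x|^k\,d\mu\le K^k$ for all $k\ge 4$. For each $N$ let $A_N=N^{-1/2}(a_{ij})_{i,j=1}^N$ be a random real symmetric matrix whose entries $a_{ij}$, $i\le j$, are i.i.d. with law $\mu$. A closed path of length $n$ is a sequence $i_0\to i_1\to\cdots\to i_n=i_0$ of vertices in $\{1,\dots,N\}$; it is called odd if some non-oriented edge (loops included) occurs in it an odd number of times, and even otherwise. Let $Z_e$ (resp. $Z_o$) denote the sum, over all even (resp. odd) closed paths of length $2s_N$, of $\mathbb{E}\prod_{j=0}^{2s_N-1} N^{-1/2}a_{i_j i_{j+1}}$. Let $(s_N)$ be a sequence of natural numbers such that $s_N\to\infty$ and $s_N=o(\sqrt N)$ as $N\to\infty$. Then all the expectations involved are those of integrable random variables and, as $N\to\infty$, $$\mathbb{E}\,\mathrm{Tr}\,A_N^{2s_N}=Z_e\,(1+o(1))=(1+o(1))\,N\,T_{0,2s_N}\,\sigma^{2s_N},\qquad T_{0,2s}=\frac{(2s)!}{s!\,(s+1)!},$$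 where $T_{0,2s}$ is the $s$-th Catalan number. In particular, $Z_e=(1+o(1))\,N\,T_{0,2s_N}\,\sigma^{2s_N}$ and $Z_o=o(Z_e)$. -/

import Mathlib

open MeasureTheory ProbabilityTheory Filter Asymptotics

noncomputable section

namespace WignerTrace

/-- A compactly supported law on the line with mean `0`, variance `σ ^ 2`, nonzero third moment,
and absolute moments of order `k ≥ 4` bounded by `K ^ k` for some constant `K`. -/
structure IsEntryLaw (μ : Measure ℝ) (σ : ℝ) : Prop where
  compact_support : IsCompact μ.support
  mean : ∫ x, x ∂μ = 0
  variance : ∫ x, x ^ 2 ∂μ = σ ^ 2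
  third_moment : ∫ x, x ^ 3 ∂μ ≠ 0
  moment_bound : ∃ K : ℝ, ∀ k : ℕ, 4 ≤ k → ∫ x, |x| ^ k ∂μ ≤ K ^ k

/-- The entries `a i j` form a symmetric array, and those with `i ≤ j` are i.i.d. of law `μ`. -/
structure IsSymmetricIID {N : ℕ} {Ω : Type*} [MeasurableSpace Ω] (P : Measure Ω)
    (μ : Measure ℝ) (a : Fin N → Fin N → Ω → ℝ) : Prop where
  symm : ∀ i j ω, a i j ω = a j i ω
  law : ∀ i j, i ≤ j → HasLaw (a i j) μ P
  indep : iIndepFun (fun (q : {q : Fin N × Fin N // q.1 ≤ q.2}) => a q.1.1 q.1.2) P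

/-- The normalized random matrix `N ^ (-1/2) (a i j)`. -/
def randomMatrix {N : ℕ} {Ω : Type*} (a : Fin N → Fin N → Ω → ℝ) (ω : Ω) :
    Matrix (Fin N) (Fin N) ℝ :=
  (1 / Real.sqrt N) • Matrix.of (fun i j => a i j ω)

/-- Closed paths `i₀ → i₁ → ⋯ → iₙ = i₀` with `n` steps on `N` vertices. -/
abbrev ClosedPath (N n : ℕ) : Type :=
  {p : Fin (n + 1) → Fin N // p (Fin.last n) = p 0}

namespace ClosedPath

variable {N n : ℕ}

/-- The non-oriented edge read at step `j` (possibly a loop). -/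
def edge (p : ClosedPath N n) (j : Fin n) : Sym2 (Fin N) :=
  s(p.1 j.castSucc, p.1 j.succ)

/-- The number of times the non-oriented edge `e` is read. -/
def edgeCount (p : ClosedPath N n) (e : Sym2 (Fin N)) : ℕ :=
  (Finset.univ.filter (fun j => p.edge j = e)).card

/-- An odd path has at least one edge that appears an odd number of times. -/
def IsOdd (p : ClosedPath N n) : Prop :=
  ∃ e, Odd (p.edgeCount e)

/-- An even path has no odd edge. -/
def IsEven (p : ClosedPath N n) : Prop :=
  ∀ e, Even (p.edgeCount e)

/-- The product of matrix entries `∏ⱼ A (iⱼ) (iⱼ₊₁)` along the path. -/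
def entryProd (p : ClosedPath N n) (A : Matrix (Fin N) (Fin N) ℝ) : ℝ :=
  ∏ j : Fin n, A (p.1 j.castSucc) (p.1 j.succ)

end ClosedPath

/-- The expected trace of the `n`-th power. -/
def expectedTrace {N : ℕ} {Ω : Type*} [MeasurableSpace Ω] (P : Measure Ω)
    (a : Fin N → Fin N → Ω → ℝ) (n : ℕ) : ℝ :=
  ∫ ω, (randomMatrix a ω ^ n).trace ∂P

open Classical in
/-- The contribution of the even closed paths of length `n` to the expected trace. -/
def evenContribution {N : ℕ} {Ω : Type*} [MeasurableSpace Ω] (P : Measure Ω)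
    (a : Fin N → Fin N → Ω → ℝ) (n : ℕ) : ℝ :=
  ∑ p : ClosedPath N n with p.IsEven, ∫ ω, p.entryProd (randomMatrix a ω) ∂P

open Classical in
/-- The contribution of the odd closed paths of length `n` to the expected trace. -/
def oddContribution {N : ℕ} {Ω : Type*} [MeasurableSpace Ω] (P : Measure Ω)
    (a : Fin N → Fin N → Ω → ℝ) (n : ℕ) : ℝ :=
  ∑ p : ClosedPath N n with p.IsOdd, ∫ ω, p.entryProd (randomMatrix a ω) ∂P

end WignerTrace

end

/-! By independence the expectation of a path product factors over edges. As the mean vanishes, only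
paths with no edge passed exactly once matter. If `|x| ≤ R * |σ|` almost surely, such a path of
length `n` with `E` distinct edges contributes at most `N^(-n/2) |σ|^n R^(n-2E)` in absolute value.
It suffices to bound the sum of absolute values over all paths, even and odd, by `(1+o(1)) N C_s
σ^(2s)`, with `C_s` the Catalan number, and to bound the even sum below by `(1-o(1))` times the same
quantity. A squeeze then gives every claim, including `Z_o = o(Z_e)`.

Upper bound: a walk is coded by opening and closing its edges. An edge passed an odd number of times
has one extra passage, a transit, that leaves it open. The number of open edges then follows a
Motzkin path, transits being level steps. The choices hidden by this code are paid for by a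
potential, essentially a product over vertices of `√(d!/2)`, where `d` counts open half-edges
(`completions_le`). An opening costs `z² = N + O(s)` and the transit after `j` others costs `(j+1) *
8R/z`. Hence the total is `C_s z^(2s)` times a geometric series of ratio `O(s/√N)` (`motzkin_le`);
both corrections tend to `1` because `s² = o(N)`.

Lower bound: walks that push a vertex off the current stack or pop back to the previous one are
even, and there are at least `C_s (N-2s-1)^s` of them from each vertex (`catalan_mul_le_card`). Each
contributes at least `N^(-s) σ^(2s)` by convexity. -/

noncomputable section
namespace WignerTrace

/-! ### Ballot numbers and weighted Motzkin paths -/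

/-- The number of `±1` paths with `n` steps from height `k` to height `0` that stay nonnegative. -/
def ballot : ℕ → ℕ → ℕ
  | 0, 0 => 1
  | 0, _ + 1 => 0
  | n + 1, 0 => ballot n 1
  | n + 1, k + 1 => ballot n (k + 2) + ballot n k

/-- This is the reflection principle, here in the form of Pascal's rule. At height `0` the missing
down step is supplied by the symmetry of the binomial coefficients. -/
theorem ballot_add_choose (n : ℕ) :
    ∀ k m : ℕ, n + k = 2 * m → ballot n k + n.choose (m + 1) = n.choose m := by
  induction n with
  | zero =>
    intro k m h
    obtain rfl | hm := Nat.eq_zero_or_pos m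
    · obtain rfl : k = 0 := by omega
      simp [ballot]
    · obtain ⟨k, rfl⟩ : ∃ l, k = l + 1 := ⟨k - 1, by omega⟩
      obtain ⟨m, rfl⟩ : ∃ l, m = l + 1 := ⟨m - 1, by omega⟩
      simp [ballot]
  | succ n ih =>
    intro k m h
    obtain ⟨m, rfl⟩ : ∃ l, m = l + 1 := ⟨m - 1, by omega⟩
    rcases k with _ | k
    · have h1 := ih 1 (m + 1) (by omega)
      have h2 : n.choose m = n.choose (m + 1) := by
        apply Nat.choose_symm_of_eq_add; omega
      simp only [ballot, Nat.choose_succ_succ]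
      simp only [Nat.succ_eq_add_one] at *
      omega
    · have h1 := ih (k + 2) (m + 1) (by omega)
      have h2 := ih k m (by omega)
      simp only [ballot, Nat.choose_succ_succ]
      simp only [Nat.succ_eq_add_one] at *
      omega

theorem ballot_two_mul (m : ℕ) : ballot (2 * m) 0 = catalan m := by
  have h1 := ballot_add_choose (2 * m) 0 m (by ring)
  have h2 := succ_mul_catalan_eq_centralBinom m
  have h3 := Nat.choose_succ_right_eq (2 * m) m
  rw [Nat.centralBinom] at h2
  have h4 : 2 * m - m = m := by omega
  rw [h4] at h3
  have h5 : (m + 1) * ballot (2 * m) 0 = (m + 1) * catalan m := by nlinarith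
  exact Nat.eq_of_mul_eq_mul_left (by omega) h5

theorem ballot_eq_zero (n : ℕ) : ∀ k, Odd (n + k) → ballot n k = 0 := by
  induction n with
  | zero =>
    rintro (_ | k) h
    · simp at h
    · rfl
  | succ n ih =>
    rintro (_ | k) h
    · exact ih 1 (by simpa using h)
    · rw [ballot, ih k (by grind), ih (k + 2) (by grind)]

/-- An up step followed by a down step can be put in front. -/
theorem ballot_le_add_two (n k : ℕ) : ballot n k ≤ ballot (n + 2) k := by
  rcases k with _ | k
  · simp [ballot]
  · simp [ballot]; omega

theorem ballot_le_catalan {m n : ℕ} (h : n ≤ 2 * m) : ballot n 0 ≤ catalan m := by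
  rcases Nat.even_or_odd' n with ⟨l, rfl | rfl⟩
  · have : Monotone fun l => ballot (2 * l) 0 :=
      monotone_nat_of_le_succ fun l => ballot_le_add_two (2 * l) 0
    rw [← ballot_two_mul]
    exact this (by omega)
  · rw [ballot_eq_zero _ _ (by simp)]; simp

/-- Nonnegative paths with `n` steps `±1` or `0` from height `k` to height `0`, where the level
steps carry the weights `(j + 1) τ, (j + 2) τ, …` in order of appearance. -/
def motzkin (τ : ℝ) : ℕ → ℕ → ℕ → ℝ
  | 0, 0, _ => 1
  | 0, _ + 1, _ => 0
  | n + 1, 0, j => motzkin τ n 1 j + (j + 1) * τ * motzkin τ n 0 (j + 1)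
  | n + 1, k + 1, j =>
    motzkin τ n (k + 2) j + motzkin τ n k j + (j + 1) * τ * motzkin τ n (k + 1) (j + 1)

theorem motzkin_nonneg {τ : ℝ} (hτ : 0 ≤ τ) (n : ℕ) : ∀ k j, 0 ≤ motzkin τ n k j := by
  induction n with
  | zero => rintro (_ | k) j <;> simp [motzkin]
  | succ n ih =>
    rintro (_ | k) j <;> simp only [motzkin]
    · have := ih 1 j; have := ih 0 (j + 1); positivity
    · have := ih (k + 2) j; have := ih k j; have := ih (k + 1) (j + 1); positivity

/-- Choosing the positions of the `i` level steps leaves a ballot path, and the weights multiply to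
`(j+1)⋯(j+i) τ^i` wherever these steps stand. -/
theorem factorial_mul_motzkin (τ : ℝ) (n : ℕ) : ∀ k j, (j.factorial : ℝ) * motzkin τ n k j =
    ∑ i ∈ Finset.HasAntidiagonal.antidiagonal n,
      (n.choose i.1 : ℝ) * (ballot i.2 k * ((j + i.1).factorial * τ ^ i.1)) := by
  induction n with
  | zero => rintro (_ | k) j <;> simp [motzkin, ballot]
  | succ n ih =>
    intro k j
    rw [Finset.sum_antidiagonal_choose_succ_mul
      (fun a b => (ballot b k : ℝ) * ((j + a).factorial * τ ^ a))]
    have hlevel : ∑ i ∈ Finset.HasAntidiagonal.antidiagonal n,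
        (n.choose i.2 : ℝ) * (ballot i.2 k * ((j + (i.1 + 1)).factorial * τ ^ (i.1 + 1))) =
        τ * ((j + 1).factorial * motzkin τ n k (j + 1)) := by
      rw [ih, Finset.mul_sum]
      refine Finset.sum_congr rfl fun i hi => ?_
      rw [Finset.HasAntidiagonal.mem_antidiagonal] at hi
      rw [Nat.choose_symm_of_eq_add (show n = i.2 + i.1 by omega),
        show j + (i.1 + 1) = j + 1 + i.1 by ring]
      ring
    rw [hlevel, Nat.factorial_succ]
    rcases k with _ | k
    · have := ih 1 j
      simp only [motzkin, ballot]
      push_cast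
      linear_combination this
    · have h1 := ih (k + 2) j
      have h2 := ih k j
      simp only [motzkin, ballot]
      push_cast
      simp only [add_mul, mul_add, Finset.sum_add_distrib] at h1 h2 ⊢
      linear_combination h1 + h2

theorem motzkin_le {τ : ℝ} (hτ : 0 ≤ τ) (m : ℕ) (h : 2 * m * τ < 1) :
    motzkin τ (2 * m) 0 0 ≤ catalan m * (1 - 2 * m * τ)⁻¹ := by
  have key := factorial_mul_motzkin τ (2 * m) 0 0
  simp only [Nat.factorial_zero, Nat.cast_one, one_mul, zero_add] at key
  rw [key, Finset.Nat.sum_antidiagonal_eq_sum_range_succ_mk]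
  have h0 : (0 : ℝ) ≤ 2 * m * τ := by positivity
  calc _ ≤ ∑ k ∈ Finset.range (2 * m + 1), (catalan m : ℝ) * (2 * m * τ) ^ k := by
        refine Finset.sum_le_sum fun k hk => ?_
        -- The growing weights `k!` cancel the denominator of the binomial coefficient, so a
        -- geometric series remains.
        have h1 : ((2 * m).choose k : ℝ) * k.factorial ≤ (2 * m : ℝ) ^ k := by
          have := Nat.descFactorial_le_pow (2 * m) k
          rw [Nat.descFactorial_eq_factorial_mul_choose, mul_comm] at this
          exact_mod_cast this
        have h2 : (ballot (2 * m - k) 0 : ℝ) ≤ catalan m := by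
          exact_mod_cast ballot_le_catalan (by omega)
        calc _ = (ballot (2 * m - k) 0 : ℝ) * ((((2 * m).choose k : ℝ) * k.factorial) * τ ^ k) := by
              ring
          _ ≤ (catalan m : ℝ) * ((2 * m : ℝ) ^ k * τ ^ k) := by gcongr
          _ = _ := by rw [← mul_pow]
    _ = catalan m * ∑ k ∈ Finset.range (2 * m + 1), (2 * m * τ) ^ k := by rw [Finset.mul_sum]
    _ ≤ _ := by
        gcongr
        rw [← tsum_geometric_of_lt_one h0 h]
        exact (summable_geometric_of_lt_one h0 h).sum_le_tsum _ fun _ _ => by positivity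

/-! ### Vertex weights -/

/-- The weight of a vertex of degree `d`. -/
def vertexWeight (d : ℕ) : ℝ := if d = 0 then 1 else √(d.factorial / 2)

theorem vertexWeight_pos (d : ℕ) : 0 < vertexWeight d := by
  unfold vertexWeight
  split_ifs
  · exact one_pos
  · have := Nat.factorial_pos d
    positivity

theorem vertexWeight_succ {d : ℕ} (hd : d ≠ 0) :
    vertexWeight (d + 1) = √(d + 1) * vertexWeight d := by
  rw [vertexWeight, vertexWeight, if_neg (by omega), if_neg hd, ← Real.sqrt_mul (by positivity),
    Nat.factorial_succ]
  push_cast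
  ring_nf

/-- Price of an opening: arriving at a vertex raises its degree by two. The factor is `1` at `d =
0`, so a fresh vertex is free; the normalization by `2` serves this. -/
theorem vertexWeight_add_two_le (d : ℕ) :
    vertexWeight (d + 2) ≤ vertexWeight d * (1 + 2 * d) := by
  obtain rfl | hd := eq_or_ne d 0
  · simp [vertexWeight]
  · have h1 : (1 : ℝ) ≤ d := by exact_mod_cast Nat.one_le_iff_ne_zero.mpr hd
    rw [show d + 2 = d + 1 + 1 by ring, vertexWeight_succ (by omega), vertexWeight_succ hd]
    have h2 : √((d + 1 : ℕ) + 1) * √(d + 1) ≤ 1 + 2 * (d : ℝ) := by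
      rw [← Real.sqrt_mul (by positivity)]
      apply Real.sqrt_le_iff.mpr ⟨by positivity, ?_⟩
      push_cast; nlinarith
    have := vertexWeight_pos d
    nlinarith

/-- Gain of a closing: the loss of two half-edges pays for the at most `d + 1` choices of the edge
to close. -/
theorem add_one_mul_vertexWeight_le (d : ℕ) :
    vertexWeight d * (d + 1) ≤ vertexWeight (d + 2) := by
  obtain rfl | hd := eq_or_ne d 0
  · simp [vertexWeight]
  · rw [show d + 2 = d + 1 + 1 by ring, vertexWeight_succ (by omega), vertexWeight_succ hd]
    have h2 : (d + 1 : ℝ) ≤ √((d + 1 : ℕ) + 1) * √(d + 1) := by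
      rw [← Real.sqrt_mul (by positivity)]
      apply Real.le_sqrt_of_sq_le
      push_cast; nlinarith
    have := vertexWeight_pos d
    nlinarith

/-! ### Walks with open edges, and their degrees -/

/-- The number of endpoints of `e` equal to `x`. -/
def endpointCount {N : ℕ} (x : Fin N) (e : Sym2 (Fin N)) : ℕ :=
  Sym2.lift ⟨fun a b => (if x = a then 1 else 0) + (if x = b then 1 else 0),
    fun _ _ => add_comm _ _⟩ e

theorem endpointCount_mk {N : ℕ} (x a b : Fin N) :
    endpointCount x s(a, b) = (if x = a then 1 else 0) + (if x = b then 1 else 0) := rfl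

theorem sum_endpointCount {N : ℕ} (e : Sym2 (Fin N)) : ∑ x, endpointCount x e = 2 := by
  induction e with
  | _ a b => simp [endpointCount_mk, Finset.sum_add_distrib]

/-- A walk in progress: its current vertex, the open edges, the visited vertices, the number of
openings that led to a visited vertex, and the number of passages through an open edge which left
it open. -/
structure WalkState (N : ℕ) where
  cur : Fin N
  opened : Finset (Sym2 (Fin N))
  visited : Finset (Fin N)
  repeats : ℕ
  transits : ℕ

namespace WalkState

variable {N : ℕ} (S : WalkState N)

/-- Move to `w`, opening the edge. -/
def up (w : Fin N) : WalkState N where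
  cur := w
  opened := insert s(S.cur, w) S.opened
  visited := insert w S.visited
  repeats := S.repeats + if w ∈ S.visited then 1 else 0
  transits := S.transits

/-- Move to `w`, closing the edge. -/
def down (w : Fin N) : WalkState N :=
  { S with cur := w, opened := S.opened.erase s(S.cur, w) }

/-- Move to `w` through an open edge, leaving it open. -/
def transit (w : Fin N) : WalkState N :=
  { S with cur := w, transits := S.transits + 1 }

/-- The walk that stands at `v` and has not moved yet. -/
def start (v : Fin N) : WalkState N := ⟨v, ∅, {v}, 0, 0⟩

/-- The sum over all completions with `n` steps that leave no edge open. -/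
def completions (R : ℝ) : ℕ → WalkState N → ℝ
  | 0, S => if S.opened = ∅ then R ^ (2 * S.repeats + S.transits) else 0
  | n + 1, S => ∑ w, if s(S.cur, w) ∈ S.opened
      then completions R n (S.down w) + completions R n (S.transit w)
      else completions R n (S.up w)

/-- The number of open half-edges at `x`, the current position counting as one of them. -/
def deg (x : Fin N) : ℕ := ∑ e ∈ S.opened, endpointCount x e + if x = S.cur then 1 else 0

theorem sum_deg : ∑ x, S.deg x = 2 * S.opened.card + 1 := by
  simp only [deg, Finset.sum_add_distrib]
  rw [Finset.sum_comm]
  simp [sum_endpointCount, mul_comm]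

theorem deg_start (v x : Fin N) : (start v).deg x = if x = v then 1 else 0 := by
  change ∑ e ∈ ∅, endpointCount x e + (if x = v then 1 else 0) = _
  simp

theorem deg_up {w : Fin N} (h : s(S.cur, w) ∉ S.opened) (x : Fin N) :
    (S.up w).deg x = S.deg x + if x = w then 2 else 0 := by
  change ∑ e ∈ insert s(S.cur, w) S.opened, endpointCount x e + (if x = w then 1 else 0) = _
  rw [Finset.sum_insert h, endpointCount_mk, deg]
  split_ifs <;> omega

theorem deg_down {w : Fin N} (h : s(S.cur, w) ∈ S.opened) (x : Fin N) :
    (S.down w).deg x + (if x = S.cur then 2 else 0) = S.deg x := by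
  change ∑ e ∈ S.opened.erase s(S.cur, w), endpointCount x e + (if x = w then 1 else 0) + _ = _
  rw [deg, ← Finset.add_sum_erase _ _ h, endpointCount_mk]
  split_ifs <;> omega

theorem deg_transit (w x : Fin N) :
    (S.transit w).deg x + (if x = S.cur then 1 else 0) = S.deg x + if x = w then 1 else 0 := by
  change ∑ e ∈ S.opened, endpointCount x e + (if x = w then 1 else 0) + _ = _
  rw [deg]
  split_ifs <;> omega

/-- Distinct next vertices use distinct open edges at the current vertex; the extra `1` is the
position itself. -/
theorem card_neighbors_lt :
    (Finset.univ.filter fun w => s(S.cur, w) ∈ S.opened).card + 1 ≤ S.deg S.cur := by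
  simp only [deg, if_true, add_le_add_iff_right]
  rw [← Finset.card_image_of_injective _ (f := fun w => s(S.cur, w))
    (fun a b h => Sym2.congr_right.mp h), Finset.card_eq_sum_ones]
  refine (Finset.sum_le_sum (g := fun e => endpointCount S.cur e) fun e he => ?_).trans
    (Finset.sum_le_sum_of_subset fun e he => ?_)
  · obtain ⟨w, -, rfl⟩ := Finset.mem_image.mp he
    simp [endpointCount_mk]
  · obtain ⟨w, hw, rfl⟩ := Finset.mem_image.mp he
    exact (Finset.mem_filter.mp hw).2

theorem deg_pos_of_mem {w : Fin N} (h : s(S.cur, w) ∈ S.opened) : 1 ≤ S.deg w := by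
  have := Finset.single_le_sum (f := fun e => endpointCount w e) (fun _ _ => Nat.zero_le _) h
  simp only [endpointCount_mk, if_true] at this
  unfold deg
  omega

/-- The invariants of a walk in progress after `L` steps. -/
structure IsReachable (L : ℕ) : Prop where
  deg_le : ∀ x, S.deg x ≤ S.transits + 2 * S.repeats + 2
  deg_eq_zero : ∀ x, x ∉ S.visited → S.deg x = 0
  card_visited_le : S.visited.card ≤ L + 1
  card_opened_le : S.opened.card ≤ L

variable {S} {L : ℕ}

theorem IsReachable.start (v : Fin N) : (start v).IsReachable 0 where
  deg_le x := by rw [deg_start]; split_ifs <;> omega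
  deg_eq_zero x hx := by
    rw [deg_start, if_neg (by simpa [WalkState.start] using hx)]
  card_visited_le := by simp [WalkState.start]
  card_opened_le := by simp [WalkState.start]

/-- A fresh vertex goes from degree `0` to `2`, which the constant `2` in the bound covers; at a
visited vertex the gain of `2` is matched by a new repeat. -/
theorem IsReachable.up (hS : S.IsReachable L) {w : Fin N} (h : s(S.cur, w) ∉ S.opened) :
    (S.up w).IsReachable (L + 1) where
  deg_le x := by
    rw [S.deg_up h]
    have h1 := hS.deg_le x
    have h2 := hS.deg_eq_zero x
    simp only [WalkState.up]
    by_cases hx : x = w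
    · subst hx
      by_cases hx : x ∈ S.visited <;> simp_all; omega
    · simp only [hx, if_false]; split_ifs <;> omega
  deg_eq_zero x hx := by
    simp only [WalkState.up, Finset.mem_insert, not_or] at hx
    rw [S.deg_up h, hS.deg_eq_zero x hx.2, if_neg hx.1]
  card_visited_le := (Finset.card_insert_le _ _).trans (by have := hS.card_visited_le; omega)
  card_opened_le := (Finset.card_insert_le _ _).trans (by have := hS.card_opened_le; omega)

theorem IsReachable.down (hS : S.IsReachable L) {w : Fin N} (h : s(S.cur, w) ∈ S.opened) :
    (S.down w).IsReachable (L + 1) where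
  deg_le x := by
    have h1 := S.deg_down h x
    have h2 := hS.deg_le x
    have h3 : (S.down w).transits = S.transits := rfl
    have h4 : (S.down w).repeats = S.repeats := rfl
    omega
  deg_eq_zero x hx := by
    have h1 := S.deg_down h x
    have h2 := hS.deg_eq_zero x hx
    omega
  card_visited_le := hS.card_visited_le.trans (by omega)
  card_opened_le := (Finset.card_erase_le).trans (hS.card_opened_le.trans (by omega))

theorem IsReachable.transit (hS : S.IsReachable L) {w : Fin N} (h : s(S.cur, w) ∈ S.opened) :
    (S.transit w).IsReachable (L + 1) where
  deg_le x := by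
    have h1 := S.deg_transit w x
    have h2 := hS.deg_le x
    have h3 : (S.transit w).transits = S.transits + 1 := rfl
    have h4 : (S.transit w).repeats = S.repeats := rfl
    split_ifs at h1 <;> omega
  deg_eq_zero x hx := by
    have h1 := S.deg_transit w x
    have h2 := hS.deg_eq_zero x hx
    -- The target of a transit carries an open edge, so it is not an unvisited vertex.
    have h3 := S.deg_pos_of_mem h
    have h4 : x ≠ w := by rintro rfl; omega
    rw [if_neg h4] at h1
    omega
  card_visited_le := hS.card_visited_le.trans (by omega)
  card_opened_le := hS.card_opened_le.trans (by omega)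

/-! ### The potential and its change at each type of step -/

variable (S) in
/-- The potential that controls the number of completions. -/
def potential (R : ℝ) : ℝ :=
  (∏ x, vertexWeight (S.deg x)) * ((4 * R ^ 2) ^ S.repeats * (8 * R) ^ S.transits /
    (S.transits + 2 * S.repeats + 2).choose S.transits)

theorem potential_pos {R : ℝ} (hR : 1 ≤ R) : 0 < S.potential R := by
  have h1 : 0 < ∏ x, vertexWeight (S.deg x) := Finset.prod_pos fun x _ => vertexWeight_pos _
  have h2 : 0 < (S.transits + 2 * S.repeats + 2).choose S.transits :=
    Nat.choose_pos (by omega)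
  unfold potential
  positivity

theorem potential_up_le {R : ℝ} (hR : 1 ≤ R) {w : Fin N} (h : s(S.cur, w) ∉ S.opened) :
    (S.up w).potential R ≤
      S.potential R * ((1 + 2 * S.deg w) * if w ∈ S.visited then 4 * R ^ 2 else 1) := by
  have h1 : ∏ x, vertexWeight ((S.up w).deg x) ≤
      (∏ x, vertexWeight (S.deg x)) * (1 + 2 * S.deg w) := by
    calc _ ≤ ∏ x, vertexWeight (S.deg x) * (if x = w then (1 + 2 * S.deg w : ℝ) else 1) := by
          refine Finset.prod_le_prod (fun x _ => (vertexWeight_pos _).le) fun x _ => ?_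
          rw [S.deg_up h]
          split_ifs with hx
          · subst hx; exact vertexWeight_add_two_le _
          · simp
      _ = _ := by rw [Finset.prod_mul_distrib]; simp
  have h2 : ((4 * R ^ 2) ^ (S.up w).repeats * (8 * R) ^ (S.up w).transits /
      ((S.up w).transits + 2 * (S.up w).repeats + 2).choose (S.up w).transits) ≤
      ((4 * R ^ 2) ^ S.repeats * (8 * R) ^ S.transits /
      (S.transits + 2 * S.repeats + 2).choose S.transits) *
        if w ∈ S.visited then 4 * R ^ 2 else 1 := by
    have h3 : 0 < (S.transits + 2 * S.repeats + 2).choose S.transits :=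
      Nat.choose_pos (by omega)
    simp only [up]
    split_ifs with hw
    · have h4 : (S.transits + 2 * S.repeats + 2).choose S.transits ≤
          (S.transits + 2 * (S.repeats + 1) + 2).choose S.transits :=
        Nat.choose_le_choose _ (by omega)
      rw [div_mul_eq_mul_div, pow_succ]
      refine (div_le_div_of_nonneg_left (by positivity) (Nat.cast_pos.mpr h3)
        (Nat.cast_le.mpr h4)).trans (le_of_eq ?_)
      ring
    · simp
  calc _ ≤ _ := mul_le_mul h1 h2 (by positivity)
        (mul_nonneg (Finset.prod_nonneg fun x _ => (vertexWeight_pos _).le) (by positivity))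
    _ = _ := by unfold potential; ring

theorem potential_down_le {R : ℝ} (hR : 1 ≤ R) {w : Fin N} (h : s(S.cur, w) ∈ S.opened) :
    (S.down w).potential R * (S.deg S.cur - 1) ≤ S.potential R := by
  have h1 : (∏ x, vertexWeight ((S.down w).deg x)) * (S.deg S.cur - 1) ≤
      ∏ x, vertexWeight (S.deg x) := by
    calc _ = ∏ x, vertexWeight ((S.down w).deg x) *
          (if x = S.cur then (S.deg S.cur - 1 : ℝ) else 1) := by rw [Finset.prod_mul_distrib]; simp
      _ ≤ _ := by
        have hd : ∀ x, vertexWeight ((S.down w).deg x) *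
            (if x = S.cur then (S.deg S.cur - 1 : ℝ) else 1) ≤ vertexWeight (S.deg x) := by
          intro x
          have := S.deg_down h x
          split_ifs with hx
          · subst hx
            rw [if_pos rfl] at this
            rw [← this]
            refine le_trans (le_of_eq ?_) (add_one_mul_vertexWeight_le _)
            push_cast; ring
          · rw [if_neg hx, add_zero] at this
            rw [this, mul_one]
        refine Finset.prod_le_prod (fun x _ => ?_) fun x _ => hd x
        have := S.deg_down h S.cur
        rw [if_pos rfl] at this
        have h2 : (0 : ℝ) ≤ S.deg S.cur - 1 := by rw [← this]; push_cast; linarith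
        have := vertexWeight_pos ((S.down w).deg x)
        split_ifs <;> positivity
  calc _ = ((∏ x, vertexWeight ((S.down w).deg x)) * (S.deg S.cur - 1)) *
        ((4 * R ^ 2) ^ S.repeats * (8 * R) ^ S.transits /
          (S.transits + 2 * S.repeats + 2).choose S.transits) := by
        simp only [potential, down]; ring
    _ ≤ _ := mul_le_mul_of_nonneg_right h1 (by positivity)

/-- A transit moves one unit of degree from the current vertex to `w`. The weights change by `√(deg
w + 1) / √(deg cur)`, and multiplying by the number `deg cur - 1` of choices gives at most `√D *
√D`. For a loop the degrees do not change. -/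
theorem prod_vertexWeight_transit_le {w : Fin N} (h : s(S.cur, w) ∈ S.opened) {D : ℝ}
    (hcur : (S.deg S.cur : ℝ) ≤ D) (hw : (S.deg w : ℝ) + 1 ≤ D) :
    (∏ x, vertexWeight ((S.transit w).deg x)) * (S.deg S.cur - 1) ≤
      (∏ x, vertexWeight (S.deg x)) * D := by
  have hpos : 0 < ∏ x, vertexWeight (S.deg x) := Finset.prod_pos fun x _ => vertexWeight_pos _
  have hcard := S.card_neighbors_lt
  have hmem : 0 < (Finset.univ.filter fun w => s(S.cur, w) ∈ S.opened).card :=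
    Finset.card_pos.mpr ⟨w, by simpa using h⟩
  have hdw := S.deg_pos_of_mem h
  obtain ⟨d, hd⟩ : ∃ d, S.deg S.cur = d + 2 := ⟨S.deg S.cur - 2, by omega⟩
  by_cases hcw : w = S.cur
  · have : ∀ x, (S.transit w).deg x = S.deg x := fun x => by
      have := S.deg_transit w x
      rw [hcw] at this ⊢
      omega
    simp only [this]
    exact mul_le_mul_of_nonneg_left (by linarith) hpos.le
  · have hD : 0 < D := by have : (0 : ℝ) ≤ S.deg w := by positivity
                          linarith
    have hfac : ∀ x, vertexWeight ((S.transit w).deg x) *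
        (if x = S.cur then (S.deg S.cur - 1 : ℝ) else 1) ≤
        vertexWeight (S.deg x) * ((if x = S.cur then √D else 1) * if x = w then √D else 1) := by
      intro x
      have hx := S.deg_transit w x
      by_cases hxc : x = S.cur
      · have hxw : x ≠ w := fun hxw => hcw (hxw.symm.trans hxc)
        rw [if_pos hxc, if_neg hxw] at hx
        rw [if_pos hxc, if_pos hxc, if_neg hxw, mul_one]
        rw [hxc, hd] at hx
        have hx' : (S.transit w).deg S.cur = d + 1 := by omega
        rw [hxc, hd, hx', vertexWeight_succ (d := d + 1) (by omega)]
        have h1 : √((d + 1 : ℕ) + 1) ≤ √D := by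
          apply Real.sqrt_le_sqrt; rw [hd] at hcur; push_cast at hcur ⊢; linarith
        have h2 : √((d + 1 : ℕ) + 1) * √((d + 1 : ℕ) + 1) = (d + 1 : ℕ) + 1 :=
          Real.mul_self_sqrt (by positivity)
        have h3 := vertexWeight_pos (d + 1)
        have h4 : ((d + 2 : ℕ) : ℝ) - 1 ≤ √((d + 1 : ℕ) + 1) * √D := by
          have := mul_le_mul_of_nonneg_left h1 (Real.sqrt_nonneg ((d + 1 : ℕ) + 1))
          push_cast at *; linarith
        calc _ ≤ vertexWeight (d + 1) * (√((d + 1 : ℕ) + 1) * √D) :=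
              mul_le_mul_of_nonneg_left h4 h3.le
          _ = _ := by ring
      · by_cases hxw : x = w
        · rw [if_neg hxc, if_pos hxw] at hx
          rw [if_neg hxc, if_neg hxc, if_pos hxw, one_mul, mul_one]
          rw [add_zero] at hx
          rw [hx, hxw, vertexWeight_succ (by omega), mul_comm]
          exact mul_le_mul_of_nonneg_left (Real.sqrt_le_sqrt hw) (vertexWeight_pos _).le
        · rw [if_neg hxc, if_neg hxw] at hx
          simp only [hxc, hxw, if_false, mul_one]
          simp only [add_zero] at hx
          rw [hx]
    have h1 : (0 : ℝ) ≤ S.deg S.cur - 1 := by rw [hd]; push_cast; linarith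
    calc _ = ∏ x, vertexWeight ((S.transit w).deg x) *
          (if x = S.cur then (S.deg S.cur - 1 : ℝ) else 1) := by rw [Finset.prod_mul_distrib]; simp
      _ ≤ ∏ x, vertexWeight (S.deg x) *
          ((if x = S.cur then √D else 1) * if x = w then √D else 1) := by
        refine Finset.prod_le_prod (fun x _ => ?_) fun x _ => hfac x
        have := vertexWeight_pos ((S.transit w).deg x)
        split_ifs <;> positivity
      _ = _ := by 
        simp_rw [Finset.prod_mul_distrib]
        simp [Real.mul_self_sqrt hD.le]

/-- The factor `D` depends on the number of repeats. The binomial in the potential is there to trade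
it for `transits + 1`, through `(j+1) * D.choose (j+1) = D * (D-1).choose j`. -/
theorem potential_transit_le {R : ℝ} (hR : 1 ≤ R) (hS : S.IsReachable L) {w : Fin N}
    (h : s(S.cur, w) ∈ S.opened) :
    (S.transit w).potential R * (S.deg S.cur - 1) ≤
      S.potential R * ((S.transits + 1) * (8 * R)) := by
  set D : ℕ := S.transits + 1 + 2 * S.repeats + 2 with hDdef
  have h1 := prod_vertexWeight_transit_le (D := D) h
    (by exact_mod_cast (hS.deg_le S.cur).trans (by omega))
    (by have := hS.deg_le w; exact_mod_cast (by omega : S.deg w + 1 ≤ D))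
  have hc : (S.transits + 1) * D.choose (S.transits + 1) =
      D * (S.transits + 2 * S.repeats + 2).choose S.transits := by
    have := Nat.add_one_mul_choose_eq (S.transits + 2 * S.repeats + 2) S.transits
    rw [show S.transits + 2 * S.repeats + 2 + 1 = D by omega] at this
    linarith
  have hc1 : 0 < (S.transits + 2 * S.repeats + 2).choose S.transits := Nat.choose_pos (by omega)
  have hc2 : 0 < D.choose (S.transits + 1) := Nat.choose_pos (by omega)
  have hcR : ((S.transits : ℝ) + 1) * D.choose (S.transits + 1) =
      D * (S.transits + 2 * S.repeats + 2).choose S.transits := by exact_mod_cast hc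
  calc _ = ((∏ x, vertexWeight ((S.transit w).deg x)) * (S.deg S.cur - 1)) *
        ((4 * R ^ 2) ^ S.repeats * (8 * R) ^ (S.transits + 1) / D.choose (S.transits + 1)) := by
        simp only [potential, transit]; ring
    _ ≤ ((∏ x, vertexWeight (S.deg x)) * D) *
        ((4 * R ^ 2) ^ S.repeats * (8 * R) ^ (S.transits + 1) / D.choose (S.transits + 1)) :=
        mul_le_mul_of_nonneg_right h1 (by positivity)
    _ = _ := by
        unfold potential
        field_simp
        linear_combination
          (-(∏ x, vertexWeight (S.deg x)) * R * R ^ S.transits * 8 ^ S.transits * 8) * hcR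

end WalkState

/-! ### Bounding the weight of all completions -/

theorem sum_le_of_forall_mul_le {ι : Type*} (F : Finset ι) (g : ι → ℝ) {D : ℕ} {A : ℝ}
    (hA : 0 ≤ A) (hF : F.card + 1 ≤ D) (hg : ∀ i ∈ F, g i * (D - 1) ≤ A) :
    ∑ i ∈ F, g i ≤ A := by
  obtain rfl | hne := F.eq_empty_or_nonempty
  · simpa
  · have h1 : (1 : ℝ) ≤ F.card := by exact_mod_cast hne.card_pos
    have h2 : (F.card : ℝ) + 1 ≤ D := by exact_mod_cast hF
    have h3 : (∑ i ∈ F, g i) * (D - 1) ≤ F.card * A := by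
      rw [Finset.sum_mul, ← nsmul_eq_mul]
      exact Finset.sum_le_card_nsmul _ _ _ hg
    have h4 : (F.card : ℝ) * A ≤ A * (D - 1) := by nlinarith
    exact le_of_mul_le_mul_right (h3.trans h4) (by linarith)

theorem choose_le_four_pow_mul (j q : ℕ) :
    ((j + 2 * q + 2).choose j : ℝ) ≤ 4 ^ q * 8 ^ j := by
  -- For `j ≥ 1` the exponent satisfies `j + 2q + 2 ≤ 2q + 3j`; at `j = 0` the binomial is `1`. This
  -- fixes the constants `4` and `8` of the potential.
  obtain rfl | hj := Nat.eq_zero_or_pos j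
  · simpa using one_le_pow₀ (by norm_num : (1 : ℝ) ≤ 4)
  · have h1 : (j + 2 * q + 2).choose j ≤ 2 ^ (j + 2 * q + 2) := Nat.choose_le_two_pow _ _
    have h2 : 2 ^ (j + 2 * q + 2) ≤ 4 ^ q * 8 ^ j := by
      rw [show 4 = 2 ^ 2 by norm_num, show 8 = 2 ^ 3 by norm_num, ← pow_mul, ← pow_mul, ← pow_add]
      exact Nat.pow_le_pow_right (by norm_num) (by omega)
    exact_mod_cast h1.trans h2

namespace WalkState

variable {N : ℕ} {S : WalkState N} {L : ℕ}

theorem card_opened_up {w : Fin N} (h : s(S.cur, w) ∉ S.opened) :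
    (S.up w).opened.card = S.opened.card + 1 := Finset.card_insert_of_notMem h

theorem card_opened_down {w : Fin N} (h : s(S.cur, w) ∈ S.opened) :
    (S.down w).opened.card = S.opened.card - 1 := Finset.card_erase_of_mem h

/-- Unvisited vertices cost `1` each. The at most `L + 1` visited ones cost `4R²(1 + 2 deg)`, and
the degrees sum to at most `2L + 1`. -/
theorem sum_potential_up_le {R : ℝ} (hR : 1 ≤ R) (hS : S.IsReachable L) :
    ∑ w ∈ Finset.univ.filter (fun w => s(S.cur, w) ∉ S.opened), (S.up w).potential R ≤
      S.potential R * (N + 4 * R ^ 2 * (5 * L + 3)) := by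
  have hP := (potential_pos hR (S := S)).le
  have hR2 : 1 ≤ R ^ 2 := one_le_pow₀ hR
  calc _ ≤ ∑ w ∈ Finset.univ.filter (fun w => s(S.cur, w) ∉ S.opened), S.potential R *
        (1 + (if w ∈ S.visited then 4 * R ^ 2 else 0) + 8 * R ^ 2 * S.deg w) := by
        refine Finset.sum_le_sum fun w hw => ?_
        refine (potential_up_le hR (Finset.mem_filter.mp hw).2).trans ?_
        refine mul_le_mul_of_nonneg_left ?_ hP
        split_ifs with hv
        · linarith
        · simp [hS.deg_eq_zero w hv]
    _ ≤ ∑ w, S.potential R *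
        (1 + (if w ∈ S.visited then 4 * R ^ 2 else 0) + 8 * R ^ 2 * S.deg w) := by
        refine Finset.sum_le_sum_of_subset_of_nonneg (Finset.subset_univ _) fun w _ _ => ?_
        refine mul_nonneg hP ?_
        split_ifs <;> positivity
    _ = S.potential R * (N + S.visited.card * (4 * R ^ 2) +
          8 * R ^ 2 * (2 * S.opened.card + 1 : ℕ)) := by
        rw [← Finset.mul_sum, Finset.sum_add_distrib, Finset.sum_add_distrib, ← Finset.mul_sum,
          ← Nat.cast_sum, S.sum_deg]
        simp
    _ ≤ _ := by
        have h1 : (S.visited.card : ℝ) ≤ L + 1 := by exact_mod_cast hS.card_visited_le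
        have h2 : (S.opened.card : ℝ) ≤ L := by exact_mod_cast hS.card_opened_le
        refine mul_le_mul_of_nonneg_left ?_ hP
        push_cast
        nlinarith

theorem potential_of_opened_eq_empty {R : ℝ} (h : S.opened = ∅) :
    S.potential R = √(1 / 2) * ((4 * R ^ 2) ^ S.repeats * (8 * R) ^ S.transits /
      (S.transits + 2 * S.repeats + 2).choose S.transits) := by
  have h1 : ∀ x, vertexWeight (S.deg x) = if x = S.cur then √(1 / 2) else 1 := by
    intro x
    rw [deg, h, Finset.sum_empty, zero_add]
    split_ifs <;> simp [vertexWeight]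
  rw [potential, Finset.prod_congr rfl fun x _ => h1 x]
  simp

/-- Each opening costs `z²`, spread as `z` over itself and its closing; the division by `z ^
S.opened.card` accounts for closings already paid. A transit is a step without partner, hence the
level weight `8R/z`. The bound `T` on the total length keeps `z` fixed through the induction. -/
theorem completions_le {R z : ℝ} (hR : 1 ≤ R) (hz0 : 0 < z) {T : ℕ}
    (hz : N + 4 * R ^ 2 * (5 * T + 3) ≤ z ^ 2) (n : ℕ) :
    ∀ {S : WalkState N} {L : ℕ}, S.IsReachable L → L + n ≤ T →
      completions R n S ≤ √2 * S.potential R * (z ^ n / z ^ S.opened.card *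
        motzkin (8 * R / z) n S.opened.card S.transits) := by
  have hτ : 0 ≤ 8 * R / z := by positivity
  induction n with
  | zero =>
    intro S L hS hL
    rw [completions]
    have hP := (potential_pos hR (S := S)).le
    split_ifs with h
    · rw [potential_of_opened_eq_empty h, h]
      have h1 := choose_le_four_pow_mul S.transits S.repeats
      have h2 : 0 < (S.transits + 2 * S.repeats + 2).choose S.transits :=
        Nat.choose_pos (by omega)
      have h3 : √2 * √(1 / 2) = 1 := by
        rw [← Real.sqrt_mul (by norm_num)]; norm_num
      simp only [Finset.card_empty, motzkin, pow_zero, div_one, mul_one]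
      rw [← mul_assoc, h3, one_mul, le_div_iff₀ (by exact_mod_cast h2), mul_pow, mul_pow, pow_add,
        pow_mul]
      have h4 : 0 ≤ (R ^ 2) ^ S.repeats * R ^ S.transits := by positivity
      nlinarith
    · have := motzkin_nonneg hτ 0 S.opened.card S.transits
      positivity
  | succ n ih =>
    intro S L hS hL
    have hP := (potential_pos hR (S := S)).le
    set j := S.transits with hj
    set k := S.opened.card with hk
    have hup : ∑ w ∈ Finset.univ.filter (fun w => s(S.cur, w) ∉ S.opened),
        completions R n (S.up w) ≤ √2 * S.potential R *
          (z ^ (n + 1) / z ^ k * motzkin (8 * R / z) n (k + 1) j) := by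
      have hm := motzkin_nonneg hτ n (k + 1) j
      calc _ ≤ ∑ w ∈ Finset.univ.filter (fun w => s(S.cur, w) ∉ S.opened),
            √2 * (S.up w).potential R *
              (z ^ n / z ^ (k + 1) * motzkin (8 * R / z) n (k + 1) j) := by
            refine Finset.sum_le_sum fun w hw => ?_
            have hw := (Finset.mem_filter.mp hw).2
            have := ih (hS.up hw) (by omega)
            rwa [card_opened_up hw] at this
        _ = √2 * (∑ w ∈ Finset.univ.filter (fun w => s(S.cur, w) ∉ S.opened),
              (S.up w).potential R) *
              (z ^ n / z ^ (k + 1) * motzkin (8 * R / z) n (k + 1) j) := by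
            rw [← Finset.sum_mul, ← Finset.mul_sum]
        _ ≤ √2 * (S.potential R * z ^ 2) *
              (z ^ n / z ^ (k + 1) * motzkin (8 * R / z) n (k + 1) j) := by
            have h1 := sum_potential_up_le hR hS
            have h2 : (N : ℝ) + 4 * R ^ 2 * (5 * L + 3) ≤ z ^ 2 := by
              have : (L : ℝ) ≤ T := by exact_mod_cast (by omega : L ≤ T)
              have : 0 ≤ R ^ 2 := by positivity
              nlinarith
            have h3 := h1.trans (mul_le_mul_of_nonneg_left h2 hP)
            gcongr
        _ = _ := by
            rw [pow_succ z k, pow_succ z n]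
            field_simp
    rw [completions, Finset.sum_ite, Finset.sum_add_distrib]
    rcases hk' : k with _ | k'
    · have hO : S.opened = ∅ := Finset.card_eq_zero.mp (hk ▸ hk')
      rw [hk', zero_add] at hup
      have hm := motzkin_nonneg hτ n 0 (j + 1)
      have hempty : Finset.univ.filter (fun w => s(S.cur, w) ∈ S.opened) = ∅ := by
        simp [hO]
      rw [hempty, Finset.sum_empty, Finset.sum_empty, zero_add, zero_add]
      refine hup.trans ?_
      simp only [motzkin]
      gcongr
      -- With no open edge only openings are possible, so the level term at height `0` is slack.
      have : 0 ≤ (j + 1) * (8 * R / z) * motzkin (8 * R / z) n 0 (j + 1) := by positivity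
      linarith
    · have hdown : ∑ w ∈ Finset.univ.filter (fun w => s(S.cur, w) ∈ S.opened),
          completions R n (S.down w) ≤ √2 * S.potential R *
            (z ^ (n + 1) / z ^ k * motzkin (8 * R / z) n k' j) := by
        have hm := motzkin_nonneg hτ n k' j
        calc _ ≤ ∑ w ∈ Finset.univ.filter (fun w => s(S.cur, w) ∈ S.opened),
              √2 * (S.down w).potential R *
                (z ^ n / z ^ k' * motzkin (8 * R / z) n k' j) := by
              refine Finset.sum_le_sum fun w hw => ?_
              have hw := (Finset.mem_filter.mp hw).2
              have := ih (hS.down hw) (by omega)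
              rwa [card_opened_down hw, ← hk, hk', Nat.add_sub_cancel] at this
          _ = √2 * (∑ w ∈ Finset.univ.filter (fun w => s(S.cur, w) ∈ S.opened),
                (S.down w).potential R) *
                (z ^ n / z ^ k' * motzkin (8 * R / z) n k' j) := by
              rw [← Finset.sum_mul, ← Finset.mul_sum]
          _ ≤ √2 * S.potential R * (z ^ n / z ^ k' * motzkin (8 * R / z) n k' j) := by
              have h1 := sum_le_of_forall_mul_le _ _ hP S.card_neighbors_lt
                fun w hw => potential_down_le hR (Finset.mem_filter.mp hw).2
              gcongr
          _ = _ := by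
              rw [hk', pow_succ z k', pow_succ z n]
              field_simp
      have htransit : ∑ w ∈ Finset.univ.filter (fun w => s(S.cur, w) ∈ S.opened),
          completions R n (S.transit w) ≤ √2 * S.potential R *
            (z ^ (n + 1) / z ^ k * ((j + 1) * (8 * R / z) *
              motzkin (8 * R / z) n k (j + 1))) := by
        have hm := motzkin_nonneg hτ n k (j + 1)
        calc _ ≤ ∑ w ∈ Finset.univ.filter (fun w => s(S.cur, w) ∈ S.opened),
              √2 * (S.transit w).potential R *
                (z ^ n / z ^ k * motzkin (8 * R / z) n k (j + 1)) := by
              refine Finset.sum_le_sum fun w hw => ?_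
              exact ih (hS.transit (Finset.mem_filter.mp hw).2) (by omega)
          _ = √2 * (∑ w ∈ Finset.univ.filter (fun w => s(S.cur, w) ∈ S.opened),
                (S.transit w).potential R) *
                (z ^ n / z ^ k * motzkin (8 * R / z) n k (j + 1)) := by
              rw [← Finset.sum_mul, ← Finset.mul_sum]
          _ ≤ √2 * (S.potential R * ((j + 1) * (8 * R))) *
                (z ^ n / z ^ k * motzkin (8 * R / z) n k (j + 1)) := by
              have h1 := sum_le_of_forall_mul_le _ _ (by positivity) S.card_neighbors_lt
                fun w hw => potential_transit_le hR hS (Finset.mem_filter.mp hw).2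
              gcongr
          _ = _ := by
              rw [pow_succ z n]
              field_simp
      rw [hk'] at hup hdown htransit
      simp only [motzkin]
      calc _ ≤ _ := add_le_add (add_le_add hdown htransit) hup
        _ = _ := by ring

theorem completions_start_le {R z : ℝ} (hR : 1 ≤ R) (hz0 : 0 < z) {m : ℕ}
    (hz : N + 4 * R ^ 2 * (10 * m + 3) ≤ z ^ 2) (hm : 2 * m * (8 * R / z) < 1) (v : Fin N) :
    completions R (2 * m) (start v) ≤
      (z ^ 2) ^ m * (catalan m * (1 - 2 * m * (8 * R / z))⁻¹) := by
  have h := completions_le hR hz0 (T := 2 * m) (by push_cast; linarith) (2 * m)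
    (IsReachable.start v) (by omega)
  rw [potential_of_opened_eq_empty rfl] at h
  simp only [start, Finset.card_empty, pow_zero, div_one, mul_one, Nat.choose_zero_right,
    Nat.cast_one] at h
  rw [← Real.sqrt_mul (by norm_num)] at h
  norm_num at h
  rw [← pow_mul]
  refine h.trans (mul_le_mul_of_nonneg_left ?_ (by positivity))
  exact motzkin_le (by positivity) m hm

end WalkState

/-! ### Passage counts and the coding of walks -/

theorem sum_fin_succ_pi {α M : Type*} [Fintype α] [AddCommMonoid M] (n : ℕ)
    (f : (Fin (n + 1) → α) → M) :
    ∑ t, f t = ∑ w, ∑ t' : Fin n → α, f (Fin.cons w t') := by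
  rw [← Fintype.sum_prod_type']
  exact (Fintype.sum_equiv (Fin.consEquiv fun _ => α) _ _ fun _ => rfl).symm

section Walk

variable {N : ℕ}

/-- The number of passages through `e` of the walk from `v` whose next vertices are `t`. -/
def passages : (n : ℕ) → Fin N → (Fin n → Fin N) → Sym2 (Fin N) → ℕ
  | 0, _, _, _ => 0
  | n + 1, v, t, e => (if s(v, t 0) = e then 1 else 0) + passages n (t 0) (Fin.tail t) e

/-- The endpoint of the walk from `v` whose next vertices are `t`. -/
def endpoint : (n : ℕ) → Fin N → (Fin n → Fin N) → Fin N
  | 0, v, _ => v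
  | n + 1, _, t => endpoint n (t 0) (Fin.tail t)

theorem endpoint_eq (n : ℕ) : ∀ p : Fin (n + 1) → Fin N,
    p (Fin.last n) = endpoint n (p 0) (Fin.tail p) := by
  induction n with
  | zero => intro p; rfl
  | succ n ih => intro p; exact ih (Fin.tail p)

theorem ClosedPath.edgeCount_eq {n : ℕ} (p : ClosedPath N n) (e : Sym2 (Fin N)) :
    p.edgeCount e = passages n (p.1 0) (Fin.tail p.1) e := by
  have key : ∀ n : ℕ, ∀ p : Fin (n + 1) → Fin N,
      (Finset.univ.filter fun j : Fin n => s(p j.castSucc, p j.succ) = e).card =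
        passages n (p 0) (Fin.tail p) e := by
    intro n
    induction n with
    | zero => intro p; rfl
    | succ n ih =>
      intro p
      rw [passages, ← ih, Finset.card_filter, Finset.card_filter, Fin.sum_univ_succ]
      rfl
  exact key n p.1

theorem sum_closedPath {M : Type*} [AddCommMonoid M] (n : ℕ) (F : (Fin (n + 1) → Fin N) → M) :
    ∑ p : ClosedPath N n, F p.1 =
      ∑ v, ∑ t : Fin n → Fin N, if endpoint n v t = v then F (Fin.cons v t) else 0 := by
  rw [← Finset.sum_subtype (Finset.univ.filter fun p : Fin (n + 1) → Fin N =>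
    p (Fin.last n) = p 0) (by simp) F, Finset.sum_filter, sum_fin_succ_pi]
  refine Finset.sum_congr rfl fun v _ => Finset.sum_congr rfl fun t _ => ?_
  rw [endpoint_eq n (Fin.cons v t)]
  simp

theorem image_eq_insert_tail {n : ℕ} (t : Fin (n + 1) → Fin N) :
    Finset.univ.image t = insert (t 0) (Finset.univ.image (Fin.tail t)) := by
  ext x
  simp [Fin.exists_fin_succ, Fin.tail, eq_comm]

theorem mem_of_passages_ne_zero (n : ℕ) : ∀ (v : Fin N) (t : Fin n → Fin N) {e : Sym2 (Fin N)},
    passages n v t e ≠ 0 → ∀ x ∈ e, x ∈ insert v (Finset.univ.image t) := by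
  induction n with
  | zero => intro v t e h; exact absurd rfl h
  | succ n ih =>
    intro v t e h x hx
    rw [image_eq_insert_tail]
    by_cases he : s(v, t 0) = e
    · subst he
      rcases Sym2.mem_iff.mp hx with rfl | rfl <;> simp
    · rw [passages, if_neg he, zero_add] at h
      exact Finset.mem_insert_of_mem (ih _ _ h x hx)

/-- The edges passed form a connected graph: a starting vertex absent from the rest of the walk also
brings a new edge. -/
theorem card_vertices_le (n : ℕ) : ∀ (v : Fin N) (t : Fin n → Fin N),
    (insert v (Finset.univ.image t)).card ≤
      (Finset.univ.filter fun e => passages n v t e ≠ 0).card + 1 := by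
  induction n with
  | zero => intro v t; simp
  | succ n ih =>
    intro v t
    rw [image_eq_insert_tail]
    have h := ih (t 0) (Fin.tail t)
    have hsub : (Finset.univ.filter fun e => passages n (t 0) (Fin.tail t) e ≠ 0) ⊆
        Finset.univ.filter fun e => passages (n + 1) v t e ≠ 0 := by
      intro e he
      simp only [Finset.mem_filter, Finset.mem_univ, true_and] at he ⊢
      rw [passages]
      omega
    by_cases hv : v ∈ insert (t 0) (Finset.univ.image (Fin.tail t))
    · rw [Finset.insert_eq_of_mem hv]
      have := Finset.card_le_card hsub
      omega
    · rw [Finset.card_insert_of_notMem hv]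
      have hnot : s(v, t 0) ∉ Finset.univ.filter fun e => passages n (t 0) (Fin.tail t) e ≠ 0 :=
        fun hmem => hv (mem_of_passages_ne_zero n _ _ (Finset.mem_filter.mp hmem).2 v (by simp))
      have hsub' := Finset.insert_subset_iff.mpr ⟨(by simp [passages] :
        s(v, t 0) ∈ Finset.univ.filter fun e => passages (n + 1) v t e ≠ 0), hsub⟩
      have := Finset.card_le_card hsub'
      rw [Finset.card_insert_of_notMem hnot] at this
      omega

theorem sum_passages (n : ℕ) : ∀ (v : Fin N) (t : Fin n → Fin N),
    ∑ e, passages n v t e = n := by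
  induction n with
  | zero => intro v t; simp [passages]
  | succ n ih => intro v t; simp [passages, Finset.sum_add_distrib, ih, add_comm]

namespace WalkState

/-- The total weight of the ways to complete `S` along `t` so that no edge stays open. -/
def typedWeight (R : ℝ) : (n : ℕ) → WalkState N → (Fin n → Fin N) → ℝ
  | 0, S, _ => if S.opened = ∅ then R ^ (2 * S.repeats + S.transits) else 0
  | n + 1, S, t => if s(S.cur, t 0) ∈ S.opened
      then typedWeight R n (S.down (t 0)) (Fin.tail t) +
        typedWeight R n (S.transit (t 0)) (Fin.tail t)
      else typedWeight R n (S.up (t 0)) (Fin.tail t)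

theorem sum_typedWeight (R : ℝ) (n : ℕ) : ∀ S : WalkState N,
    ∑ t, typedWeight R n S t = completions R n S := by
  induction n with
  | zero => intro S; simp [typedWeight, completions]
  | succ n ih =>
    intro S
    rw [sum_fin_succ_pi, completions]
    refine Finset.sum_congr rfl fun w _ => ?_
    simp only [typedWeight, Fin.cons_zero, Fin.tail_cons]
    split_ifs
    · rw [Finset.sum_add_distrib, ih, ih]
    · exact ih _

theorem typedWeight_nonneg {R : ℝ} (hR : 0 ≤ R) (n : ℕ) : ∀ (S : WalkState N) (t : Fin n → Fin N),
    0 ≤ typedWeight R n S t := by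
  induction n with
  | zero => intro S t; rw [typedWeight]; split_ifs <;> positivity
  | succ n ih =>
    intro S t
    rw [typedWeight]
    have := ih (S.down (t 0)) (Fin.tail t)
    have := ih (S.transit (t 0)) (Fin.tail t)
    have := ih (S.up (t 0)) (Fin.tail t)
    split_ifs <;> positivity

/-- One typing suffices, the others being nonnegative: an open edge is left open exactly when one
passage through it remains, and closed otherwise. Then open edges will be passed again and the other
edges are never left with a single passage. The last hypothesis is a budget kept by every step; at
the end it reads `m ≤ 2 * repeats + transits`. -/
theorem pow_le_typedWeight {R : ℝ} (hR : 1 ≤ R) {m : ℕ} (n : ℕ) :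
    ∀ (S : WalkState N) (t : Fin n → Fin N),
      (∀ e ∈ S.opened, passages n S.cur t e ≠ 0) →
      (∀ e ∉ S.opened, passages n S.cur t e ≠ 1) →
      m + S.opened.card + 2 * (S.visited ∪ Finset.univ.image t).card ≤
        2 * S.repeats + S.transits + n + 2 * S.visited.card →
      R ^ m ≤ typedWeight R n S t := by
  have hR0 : 0 ≤ R := by linarith
  induction n with
  | zero =>
    intro S t hO _ hm
    have hempty : S.opened = ∅ := by
      by_contra hne
      obtain ⟨e, he⟩ := Finset.nonempty_iff_ne_empty.mpr hne
      exact hO e he rfl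
    rw [typedWeight, if_pos hempty]
    refine pow_le_pow_right₀ hR ?_
    simp at hm
    omega
  | succ n ih =>
    intro S t hO hO' hm
    rw [typedWeight]
    set w := t 0 with hw
    set e₀ := s(S.cur, w) with he₀
    have hcount : ∀ e, e ≠ e₀ → passages (n + 1) S.cur t e = passages n w (Fin.tail t) e := by
      intro e he
      rw [passages, if_neg (Ne.symm he), zero_add]
    have hcount₀ : passages (n + 1) S.cur t e₀ = 1 + passages n w (Fin.tail t) e₀ := by
      rw [passages, if_pos rfl]
    rw [image_eq_insert_tail, ← hw] at hm
    have hunion : (S.visited ∪ Finset.univ.image (Fin.tail t)).card ≤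
        (S.visited ∪ insert w (Finset.univ.image (Fin.tail t))).card :=
      Finset.card_le_card (Finset.union_subset_union_right (Finset.subset_insert _ _))
    split_ifs with hmem
    · by_cases hone : passages n w (Fin.tail t) e₀ = 1
      · refine le_add_of_nonneg_of_le (typedWeight_nonneg hR0 _ _ _)
          (ih (S.transit w) (Fin.tail t) ?_ ?_ ?_)
        · intro e he
          obtain rfl | hne := eq_or_ne e e₀
          · change passages n w _ _ ≠ 0
            omega
          · change passages n w _ _ ≠ 0
            rw [← hcount e hne]; exact hO e he
        · intro e he
          have hne : e ≠ e₀ := fun h => he (h ▸ hmem)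
          change passages n w _ _ ≠ 1
          rw [← hcount e hne]; exact hO' e he
        · simp only [transit]
          omega
      · refine le_add_of_le_of_nonneg (ih (S.down w) (Fin.tail t) ?_ ?_ ?_)
          (typedWeight_nonneg hR0 _ _ _)
        · intro e he
          obtain ⟨hne, he⟩ := Finset.mem_erase.mp he
          change passages n w _ _ ≠ 0
          rw [← hcount e hne]; exact hO e he
        · intro e he
          change passages n w _ _ ≠ 1
          obtain rfl | hne := eq_or_ne e e₀
          · exact hone
          · rw [← hcount e hne]
            exact hO' e fun h => he (Finset.mem_erase.mpr ⟨hne, h⟩)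
        · have h1 := card_opened_down hmem
          have h2 := Finset.card_pos.mpr ⟨_, hmem⟩
          rw [h1]
          simp only [down]
          omega
    · refine ih (S.up w) (Fin.tail t) ?_ ?_ ?_
      · intro e he
        change passages n w _ _ ≠ 0
        obtain rfl | hne := eq_or_ne e e₀
        · have := hO' e₀ hmem
          omega
        · rw [← hcount e hne]
          exact hO e ((Finset.mem_insert.mp he).resolve_left hne)
      · intro e he
        obtain ⟨hne, he⟩ := not_or.mp (Finset.mem_insert.not.mp he)
        change passages n w _ _ ≠ 1
        rw [← hcount e hne]
        exact hO' e he
      · rw [card_opened_up hmem]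
        have h1 : (S.up w).visited ∪ Finset.univ.image (Fin.tail t) =
            S.visited ∪ insert w (Finset.univ.image (Fin.tail t)) := by
          simp [up, Finset.insert_union, Finset.union_insert]
        rw [h1]
        have h2 : (S.up w).repeats + (S.up w).visited.card = S.repeats + S.visited.card + 1 := by
          by_cases hv : w ∈ S.visited
          · simp [up, hv]; omega
          · simp [up, hv]; omega
        have h3 : (S.up w).transits = S.transits := rfl
        omega

end WalkState

theorem sum_pow_le_sum_completions {R : ℝ} (hR : 1 ≤ R) (n : ℕ) (v : Fin N) :
    ∑ t : Fin n → Fin N, (if ∀ e, passages n v t e ≠ 1 then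
      R ^ (n - 2 * (Finset.univ.filter fun e => passages n v t e ≠ 0).card) else 0) ≤
      WalkState.completions R n (WalkState.start v) := by
  rw [← WalkState.sum_typedWeight]
  refine Finset.sum_le_sum fun t _ => ?_
  split_ifs with h
  · refine WalkState.pow_le_typedWeight hR n _ _ ?_ (fun e _ => h e) ?_
    · simp [WalkState.start]
    · have h1 := card_vertices_le n v t
      -- Every edge used is passed at least twice, so the subtraction in the exponent is not
      -- truncated.
      have h2 : 2 * (Finset.univ.filter fun e => passages n v t e ≠ 0).card ≤ n := by
        conv_rhs => rw [← sum_passages n v t]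
        rw [mul_comm, ← smul_eq_mul, ← Finset.sum_const, Finset.sum_filter]
        refine Finset.sum_le_sum fun e _ => ?_
        have := h e
        split_ifs <;> omega
      simp only [WalkState.start, Finset.card_empty, Finset.card_singleton,
        Finset.singleton_union]
      omega
  · exact WalkState.typedWeight_nonneg (by linarith) _ _ _

/-! ### Lower bound on the number of even walks -/

/-- The edges of the path through the vertices of a list. -/
def chainEdges : List (Fin N) → Finset (Sym2 (Fin N))
  | [] => ∅
  | [_] => ∅
  | a :: b :: l => insert s(a, b) (chainEdges (b :: l))

theorem mem_of_mem_chainEdges : ∀ (l : List (Fin N)) {e : Sym2 (Fin N)}, e ∈ chainEdges l →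
    ∀ x ∈ e, x ∈ l
  | [], _, h => by simp [chainEdges] at h
  | [_], _, h => by simp [chainEdges] at h
  | a :: b :: l, e, h => by
    intro x hx
    rcases Finset.mem_insert.mp h with rfl | h
    · rcases Sym2.mem_iff.mp hx with rfl | rfl <;> simp
    · exact List.mem_cons_of_mem _ (mem_of_mem_chainEdges (b :: l) h x hx)

/-- The walk ends at `r` and the edges with an odd number of passages are those in `O`. -/
def HasOddEdges (n : ℕ) (v : Fin N) (t : Fin n → Fin N) (O : Finset (Sym2 (Fin N)))
    (r : Fin N) : Prop :=
  (∀ e, e ∈ O ↔ Odd (passages n v t e)) ∧ endpoint n v t = r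

theorem HasOddEdges.cons_erase {n : ℕ} {v w r : Fin N} {t : Fin n → Fin N}
    {O : Finset (Sym2 (Fin N))} (hO : s(v, w) ∉ O) (h : HasOddEdges n w t (insert s(v, w) O) r) :
    HasOddEdges (n + 1) v (Fin.cons w t) O r := by
  refine ⟨fun e => ?_, by simpa [endpoint] using h.2⟩
  have := h.1 e
  simp only [passages, Fin.cons_zero, Fin.tail_cons]
  rw [Finset.mem_insert] at this
  split_ifs with he
  · subst he
    simp only [true_or, true_iff] at this
    simp only [hO, false_iff, Nat.not_odd_iff_even]
    grind
  · simpa [Ne.symm he] using this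

theorem HasOddEdges.cons_insert {n : ℕ} {v w r : Fin N} {t : Fin n → Fin N}
    {O : Finset (Sym2 (Fin N))} (hO : s(v, w) ∉ O) (h : HasOddEdges n w t O r) :
    HasOddEdges (n + 1) v (Fin.cons w t) (insert s(v, w) O) r := by
  refine ⟨fun e => ?_, by simpa [endpoint] using h.2⟩
  have := h.1 e
  simp only [passages, Fin.cons_zero, Fin.tail_cons]
  rw [Finset.mem_insert]
  split_ifs with he
  · subst he
    simp only [hO, false_iff, Nat.not_odd_iff_even] at this
    simp only [true_or, true_iff]
    grind
  · simpa [Ne.symm he] using this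

open Classical in
-- The list is a stack of distinct vertices, and its chain edges are those still to be passed an odd
-- number of times. A walk pushes a vertex off the stack, in at least `y ^ 2` ways, or pops. A
-- ballot path of `n` steps from height `k` has `(n - k) / 2` pushes, which explains the powers of
-- `y`.
theorem ballot_mul_le_card {y : ℝ} (hy : 0 ≤ y) {r : Fin N} (n : ℕ) :
    ∀ (v : Fin N) (l : List (Fin N)), (v :: l).Nodup → (v :: l).getLast (by simp) = r →
      y ^ 2 + (l.length + n + 1) ≤ N →
      ballot n l.length * y ^ n ≤ y ^ l.length *
        ∑ t : Fin n → Fin N, if HasOddEdges n v t (chainEdges (v :: l)) r then (1 : ℝ) else 0 := by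
  induction n with
  | zero =>
    rintro v (_ | ⟨b, l⟩) hnd hlast hN
    · have : ∀ t, HasOddEdges 0 v t (chainEdges [v]) r := fun t =>
        ⟨fun e => by simp [chainEdges, passages], by simpa [endpoint] using hlast⟩
      simp [this, ballot]
    · simp only [List.length_cons, ballot]
      have : (0 : ℝ) ≤ ∑ t : Fin 0 → Fin N,
          if HasOddEdges 0 v t (chainEdges (v :: b :: l)) r then (1 : ℝ) else 0 :=
        Finset.sum_nonneg fun t _ => by split_ifs <;> norm_num
      push_cast
      rw [zero_mul]
      positivity
  | succ n ih =>
    intro v l hnd hlast hN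
    rw [sum_fin_succ_pi]
    set f : Fin N → ℝ := fun w => ∑ t' : Fin n → Fin N,
      if HasOddEdges (n + 1) v (Fin.cons w t') (chainEdges (v :: l)) r then (1 : ℝ) else 0 with hf
    have hf0 : ∀ w, 0 ≤ f w := fun w =>
      Finset.sum_nonneg fun t _ => by split_ifs <;> norm_num
    have hpush : ∀ w ∉ v :: l, ballot n (l.length + 1) * y ^ n ≤ y ^ (l.length + 1) * f w := by
      intro w hw
      have hedge : s(v, w) ∉ chainEdges (v :: l) := fun h =>
        hw (mem_of_mem_chainEdges _ h w (by simp))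
      have h1 := ih w (v :: l) (List.nodup_cons.mpr ⟨hw, hnd⟩)
        (by rwa [List.getLast_cons (by simp)]) (by push_cast at hN ⊢; simp; linarith)
      refine h1.trans (mul_le_mul_of_nonneg_left (Finset.sum_le_sum fun t _ => ?_) (by positivity))
      have himp : HasOddEdges n w t (chainEdges (w :: v :: l)) r →
          HasOddEdges (n + 1) v (Fin.cons w t) (chainEdges (v :: l)) r := by
        rw [chainEdges, Sym2.eq_swap]
        exact HasOddEdges.cons_erase hedge
      split_ifs <;> first | exact le_rfl | exact zero_le_one | tauto
    have hcard : y ^ 2 ≤ ((Finset.univ.filter fun w => w ∉ v :: l).card : ℝ) := by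
      have h1 : (Finset.univ.filter fun w => w ∉ v :: l).card + (l.length + 1) = N := by
        have h2 : (Finset.univ.filter fun w => w ∈ v :: l).card = l.length + 1 := by
          have : (Finset.univ.filter fun w => w ∈ v :: l) = (v :: l).toFinset := by ext; simp
          rw [this, List.toFinset_card_of_nodup hnd, List.length_cons]
        have h3 := Finset.card_filter_add_card_filter_not (s := Finset.univ)
          (fun w : Fin N => w ∈ v :: l)
        rw [h2] at h3
        simp only [Finset.card_univ, Fintype.card_fin] at h3
        omega
      have h2 : ((Finset.univ.filter fun w => w ∉ v :: l).card : ℝ) + (l.length + 1) = N := by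
        exact_mod_cast h1
      push_cast at hN
      have : (0 : ℝ) ≤ n := by positivity
      linarith
    have hsumpush : ballot n (l.length + 1) * y ^ (n + 1) ≤
        y ^ l.length * ∑ w ∈ Finset.univ.filter (fun w => w ∉ v :: l), f w := by
      -- One factor `y` is cancelled below, so `y = 0` is set apart.
      obtain rfl | hy0 := hy.eq_or_lt
      · rw [zero_pow (by omega), mul_zero]
        exact mul_nonneg (by positivity) (Finset.sum_nonneg fun w _ => hf0 w)
      · have h1 := Finset.card_nsmul_le_sum (Finset.univ.filter fun w => w ∉ v :: l)
          (fun w => y ^ (l.length + 1) * f w) _ fun w hw => hpush w (Finset.mem_filter.mp hw).2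
        rw [nsmul_eq_mul, ← Finset.mul_sum] at h1
        have h2 := (mul_le_mul_of_nonneg_right hcard
          (by positivity : 0 ≤ ballot n (l.length + 1) * y ^ n)).trans h1
        refine le_of_mul_le_mul_left ?_ hy0
        calc _ = y ^ 2 * (ballot n (l.length + 1) * y ^ n) := by ring
          _ ≤ _ := h2
          _ = _ := by ring
    rcases l with _ | ⟨b, l⟩
    · simp only [List.length_nil, ballot] at hsumpush ⊢
      refine hsumpush.trans (mul_le_mul_of_nonneg_left ?_ (by positivity))
      exact Finset.sum_le_sum_of_subset_of_nonneg (Finset.subset_univ _) fun w _ _ => hf0 w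
    · have hnd' := List.nodup_cons.mp hnd
      have hedge : s(v, b) ∉ chainEdges (b :: l) := fun h =>
        hnd'.1 (mem_of_mem_chainEdges _ h v (by simp))
      have hpop : ballot n l.length * y ^ n ≤ y ^ l.length * f b := by
        have h1 := ih b l hnd'.2 (by rwa [List.getLast_cons (by simp)] at hlast)
          (by push_cast [List.length_cons] at hN ⊢; linarith)
        refine h1.trans (mul_le_mul_of_nonneg_left (Finset.sum_le_sum fun t _ => ?_)
          (by positivity))
        have himp : HasOddEdges n b t (chainEdges (b :: l)) r →
            HasOddEdges (n + 1) v (Fin.cons b t) (chainEdges (v :: b :: l)) r :=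
          HasOddEdges.cons_insert hedge
        split_ifs <;> first | exact le_rfl | exact zero_le_one | tauto
      -- The popped vertex `b` lies on the stack, so pops and pushes give different walks.
      have hsplit : f b + ∑ w ∈ Finset.univ.filter (fun w => w ∉ v :: b :: l), f w ≤ ∑ w, f w := by
        rw [← Finset.sum_insert (by simp)]
        exact Finset.sum_le_sum_of_subset_of_nonneg (Finset.subset_univ _) fun w _ _ => hf0 w
      simp only [List.length_cons, ballot] at hsumpush ⊢
      calc _ = ballot n (l.length + 2) * y ^ (n + 1) + y * (ballot n l.length * y ^ n) := by
            push_cast; ring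
        _ ≤ y ^ (l.length + 1) * ∑ w ∈ Finset.univ.filter (fun w => w ∉ v :: b :: l), f w +
            y * (y ^ l.length * f b) := add_le_add hsumpush (mul_le_mul_of_nonneg_left hpop hy)
        _ = y ^ (l.length + 1) *
            (f b + ∑ w ∈ Finset.univ.filter (fun w => w ∉ v :: b :: l), f w) := by ring
        _ ≤ _ := mul_le_mul_of_nonneg_left hsplit (by positivity)

open Classical in
theorem catalan_mul_le_card {y : ℝ} (hy : 0 ≤ y) (m : ℕ) (hN : y ^ 2 + (2 * m + 1) ≤ N)
    (v : Fin N) : catalan m * (y ^ 2) ^ m ≤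
      ∑ t : Fin (2 * m) → Fin N, if HasOddEdges (2 * m) v t ∅ v then (1 : ℝ) else 0 := by
  have := ballot_mul_le_card hy (r := v) (2 * m) v [] (by simp) (by simp)
    (by push_cast [List.length_nil]; linarith)
  simp only [List.length_nil, ballot_two_mul, chainEdges, pow_zero, one_mul] at this
  rwa [pow_mul] at this

end Walk

/-! ### Moments of the entries -/

section Moments

variable {μ : Measure ℝ} {σ M : ℝ}

theorem IsEntryLaw.exists_bound (hμ : IsEntryLaw μ σ) : ∃ M : ℝ, ∀ᵐ x ∂μ, |x| ≤ M := by
  obtain ⟨M, hM⟩ := hμ.compact_support.isBounded.exists_norm_le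
  exact ⟨M, by filter_upwards [Measure.support_mem_ae (μ := μ)] with x hx using hM x hx⟩

variable [IsProbabilityMeasure μ]

theorem integrable_pow_of_bound (hM : ∀ᵐ x ∂μ, |x| ≤ M) (c : ℕ) :
    Integrable (fun x : ℝ => x ^ c) μ := by
  refine Integrable.of_bound (by fun_prop) (M ^ c) ?_
  filter_upwards [hM] with x hx
  rw [Real.norm_eq_abs, abs_pow]
  gcongr

/-- A zero variance would make the law a point mass at `0`, whose third moment vanishes. -/
theorem IsEntryLaw.sigma_ne_zero (hμ : IsEntryLaw μ σ) : σ ≠ 0 := by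
  rintro rfl
  obtain ⟨M, hM⟩ := hμ.exists_bound
  have h := hμ.variance
  rw [zero_pow two_ne_zero, integral_eq_zero_iff_of_nonneg (fun x => sq_nonneg x)
    (integrable_pow_of_bound hM 2)] at h
  refine hμ.third_moment ((integral_congr_ae (g := fun _ => 0) ?_).trans (by simp))
  filter_upwards [h] with x hx
  have : x = 0 := by simpa using hx
  simp [this]

theorem IsEntryLaw.exists_ratio (hμ : IsEntryLaw μ σ) :
    ∃ R : ℝ, 1 ≤ R ∧ ∀ᵐ x ∂μ, |x| ≤ R * |σ| := by
  obtain ⟨M, hM⟩ := hμ.exists_bound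
  have hσ := abs_pos.mpr hμ.sigma_ne_zero
  refine ⟨max 1 (M / |σ|), le_max_left _ _, ?_⟩
  filter_upwards [hM] with x hx
  calc |x| ≤ M / |σ| * |σ| := by rwa [div_mul_cancel₀ _ hσ.ne']
    _ ≤ _ := mul_le_mul_of_nonneg_right (le_max_right _ _) hσ.le

theorem IsEntryLaw.abs_moment_le (hμ : IsEntryLaw μ σ) {R : ℝ}
    (hM : ∀ᵐ x ∂μ, |x| ≤ R * |σ|) {c : ℕ} (hc : c ≠ 1) :
    |∫ x, x ^ c ∂μ| ≤ |σ| ^ c * R ^ (c - 2) := by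
  rcases c with _ | _ | c
  · simp
  · exact absurd rfl hc
  · calc |∫ x, x ^ (c + 2) ∂μ| ≤ ∫ x, |x ^ (c + 2)| ∂μ := abs_integral_le_integral_abs
      _ ≤ ∫ x, (R * |σ|) ^ c * x ^ 2 ∂μ := by
        refine integral_mono_ae (integrable_pow_of_bound hM _).abs
          ((integrable_pow_of_bound hM 2).const_mul _) ?_
        filter_upwards [hM] with x hx
        change |x ^ (c + 2)| ≤ _
        rw [abs_pow, pow_add, sq_abs]
        gcongr
      _ = _ := by
        rw [integral_const_mul, hμ.variance, ← sq_abs σ]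
        change _ = |σ| ^ (c + 2) * R ^ c
        ring

theorem IsEntryLaw.pow_le_moment (hμ : IsEntryLaw μ σ) {c : ℕ} (hc : Even c) :
    |σ| ^ c ≤ ∫ x, x ^ c ∂μ := by
  obtain ⟨M, hM⟩ := hμ.exists_bound
  obtain ⟨k, rfl⟩ := hc.two_dvd
  have hσ2 : 0 < σ ^ 2 := by have := hμ.sigma_ne_zero; positivity
  have hint := integrable_pow_of_bound hM 2
  -- `A + B * u` is the tangent to `u ^ k` at `u = σ ^ 2`. At `u = x ^ 2` its mean is `σ ^ (2k)`,
  -- and Bernoulli's inequality places it below the power: this is Jensen's inequality.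
  set A : ℝ := (σ ^ 2) ^ k * (1 - k) with hA
  set B : ℝ := (σ ^ 2) ^ k * k / σ ^ 2 with hB
  have hint' : Integrable (fun x : ℝ => A + B * x ^ 2) μ :=
    (integrable_const A).add (hint.const_mul B)
  calc |σ| ^ (2 * k) = ∫ x, (A + B * x ^ 2) ∂μ := by
        rw [integral_add (integrable_const A) (hint.const_mul B), integral_const_mul B, hμ.variance,
          hA, hB, pow_mul, sq_abs, div_mul_cancel₀ _ hσ2.ne']
        simp only [integral_const, probReal_univ, smul_eq_mul]
        ring
    _ ≤ _ := by
      refine integral_mono hint' (integrable_pow_of_bound hM _) fun x => ?_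
      have h2 : 0 ≤ x ^ 2 / σ ^ 2 := by positivity
      have h3 := one_add_mul_le_pow (a := x ^ 2 / σ ^ 2 - 1) (by linarith) k
      calc A + B * x ^ 2 = (σ ^ 2) ^ k * (1 + k * (x ^ 2 / σ ^ 2 - 1)) := by rw [hA, hB]; ring
        _ ≤ (σ ^ 2) ^ k * (1 + (x ^ 2 / σ ^ 2 - 1)) ^ k := by gcongr
        _ = x ^ (2 * k) := by
          rw [← mul_pow, pow_mul, add_sub_cancel, mul_div_cancel₀ _ hσ2.ne']

end Moments

/-! ### From expectations to walk counts -/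

section Expectation

variable {N : ℕ} {Ω : Type*} [MeasurableSpace Ω] {P : Measure Ω} {μ : Measure ℝ}
  {a : Fin N → Fin N → Ω → ℝ}

theorem IsSymmetricIID.hasLaw (ha : IsSymmetricIID P μ a) (i j : Fin N) : HasLaw (a i j) μ P := by
  rcases le_total i j with h | h
  · exact ha.law i j h
  · rw [show a i j = a j i from funext fun ω => ha.symm i j ω]
    exact ha.law j i h

theorem entryProd_randomMatrix {Ω : Type*} {a : Fin N → Fin N → Ω → ℝ} {n : ℕ}
    (p : ClosedPath N n) (ω : Ω) :
    p.entryProd (randomMatrix a ω) =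
      (1 / √N) ^ n * ∏ j : Fin n, a (p.1 j.castSucc) (p.1 j.succ) ω := by
  simp [ClosedPath.entryProd, randomMatrix, Finset.prod_mul_distrib]

theorem IsSymmetricIID.prod_eq (ha : IsSymmetricIID P μ a) {n : ℕ} (p : ClosedPath N n) (ω : Ω) :
    ∏ j : Fin n, a (p.1 j.castSucc) (p.1 j.succ) ω =
      ∏ e : Sym2 (Fin N), a e.inf e.sup ω ^ p.edgeCount e := by
  have h1 : ∀ i j, a i j ω = a s(i, j).inf s(i, j).sup ω := by
    intro i j
    rcases le_total i j with h | h
    · simp [h]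
    · simp [h, ha.symm i j]
  calc _ = ∏ j : Fin n, a (p.edge j).inf (p.edge j).sup ω :=
        Finset.prod_congr rfl fun j _ => h1 _ _
    _ = ∏ e : Sym2 (Fin N), ∏ j ∈ Finset.univ.filter (fun j => p.edge j = e),
          a e.inf e.sup ω := (Finset.prod_fiberwise' _ _ fun e : Sym2 (Fin N) => a e.inf e.sup ω).symm
    _ = _ := by simp [ClosedPath.edgeCount]

theorem IsSymmetricIID.integral_entryProd (ha : IsSymmetricIID P μ a) {n : ℕ}
    (p : ClosedPath N n) :
    ∫ ω, p.entryProd (randomMatrix a ω) ∂P =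
      (1 / √N) ^ n * ∏ e, ∫ x, x ^ p.edgeCount e ∂μ := by
  simp_rw [entryProd_randomMatrix, ha.prod_eq]
  rw [integral_const_mul]
  congr 1
  have hind : iIndepFun (fun (e : Sym2 (Fin N)) => a e.inf e.sup) P :=
    ha.indep.precomp (Sym2.sortEquiv (α := Fin N)).injective
  have hind' := hind.comp (fun e x => x ^ p.edgeCount e) (fun e => by fun_prop)
  refine (hind'.integral_fun_prod_eq_prod_integral fun e =>
    ((ha.hasLaw e.inf e.sup).aemeasurable.pow_const _).aestronglyMeasurable).trans ?_
  exact Finset.prod_congr rfl fun e _ =>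
    (ha.hasLaw e.inf e.sup).integral_comp (f := fun x => x ^ p.edgeCount e) (by fun_prop)

theorem IsSymmetricIID.integrable_entryProd [IsFiniteMeasure P] (ha : IsSymmetricIID P μ a)
    {M : ℝ} (hM : ∀ᵐ x ∂μ, |x| ≤ M) {n : ℕ} (p : ClosedPath N n) :
    Integrable (fun ω => p.entryProd (randomMatrix a ω)) P := by
  simp_rw [entryProd_randomMatrix]
  refine Integrable.const_mul (Integrable.of_bound ?_ (M ^ n) ?_) _
  · exact (Finset.aemeasurable_fun_prod _ fun j _ =>
      (ha.hasLaw _ _).aemeasurable).aestronglyMeasurable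
  · have h : ∀ᵐ ω ∂P, ∀ i j, |a i j ω| ≤ M := by
      rw [ae_all_iff]; intro i
      rw [ae_all_iff]; intro j
      exact ((ha.hasLaw i j).ae_iff (p := fun x => |x| ≤ M) (by fun_prop)).mpr hM
    filter_upwards [h] with ω hω
    rw [Real.norm_eq_abs, Finset.abs_prod]
    exact (Finset.prod_le_prod (fun _ _ => abs_nonneg _) fun j _ => hω _ _).trans (by simp)

theorem pow_apply_eq_sum (A : Matrix (Fin N) (Fin N) ℝ) (n : ℕ) : ∀ v u : Fin N,
    (A ^ n) v u = ∑ t : Fin n → Fin N, if endpoint n v t = u then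
      ∏ j : Fin n, A ((Fin.cons v t : Fin (n + 1) → Fin N) j.castSucc)
        ((Fin.cons v t : Fin (n + 1) → Fin N) j.succ) else 0 := by
  induction n with
  | zero => intro v u; simp [endpoint, Matrix.one_apply]
  | succ n ih =>
    intro v u
    rw [pow_succ', Matrix.mul_apply, sum_fin_succ_pi]
    refine Finset.sum_congr rfl fun w _ => ?_
    rw [ih, Finset.mul_sum]
    refine Finset.sum_congr rfl fun t _ => ?_
    rw [endpoint, Fin.cons_zero, Fin.tail_cons, Fin.prod_univ_succ, mul_ite, mul_zero]
    rfl

theorem trace_pow_eq_sum (A : Matrix (Fin N) (Fin N) ℝ) (n : ℕ) :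
    (A ^ n).trace = ∑ p : ClosedPath N n, p.entryProd A := by
  unfold ClosedPath.entryProd
  rw [sum_closedPath n fun p => ∏ j : Fin n, A (p j.castSucc) (p j.succ)]
  exact Finset.sum_congr rfl fun v _ => pow_apply_eq_sum A n v v

theorem ClosedPath.isOdd_iff {n : ℕ} (p : ClosedPath N n) : p.IsOdd ↔ ¬p.IsEven := by
  simp [ClosedPath.IsOdd, ClosedPath.IsEven]

theorem expectedTrace_eq (hint : ∀ n (p : ClosedPath N n),
      Integrable (fun ω => p.entryProd (randomMatrix a ω)) P) (n : ℕ) :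
    expectedTrace P a n = evenContribution P a n + oddContribution P a n := by
  classical
  unfold expectedTrace evenContribution oddContribution
  simp_rw [trace_pow_eq_sum]
  rw [integral_finsetSum _ fun p _ => hint n p,
    ← Finset.sum_filter_add_sum_filter_not Finset.univ (fun p : ClosedPath N n => p.IsEven)]
  congr 1
  refine Finset.sum_congr ?_ fun _ _ => rfl
  ext p
  simp only [Finset.mem_filter, Finset.mem_univ, true_and, p.isOdd_iff]

variable [IsProbabilityMeasure μ] {σ : ℝ}

/-- An edge passed once contributes the zero mean; an edge passed `c ≥ 2` times contributes at most
`|σ|^c R^(c-2)`, and the excesses `c - 2` add up to the exponent of `R`. -/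
theorem IsSymmetricIID.abs_integral_entryProd_le (ha : IsSymmetricIID P μ a)
    (hμ : IsEntryLaw μ σ) {R : ℝ} (hM : ∀ᵐ x ∂μ, |x| ≤ R * |σ|) {n : ℕ}
    (p : ClosedPath N n) :
    |∫ ω, p.entryProd (randomMatrix a ω) ∂P| ≤ (1 / √N) ^ n * |σ| ^ n *
      if ∀ e, passages n (p.1 0) (Fin.tail p.1) e ≠ 1 then
        R ^ (n - 2 * (Finset.univ.filter fun e =>
          passages n (p.1 0) (Fin.tail p.1) e ≠ 0).card) else 0 := by
  rw [ha.integral_entryProd, abs_mul, abs_of_nonneg (by positivity), mul_assoc, Finset.abs_prod]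
  refine mul_le_mul_of_nonneg_left ?_ (by positivity)
  simp_rw [p.edgeCount_eq]
  have hsum := sum_passages n (p.1 0) (Fin.tail p.1)
  set c := passages n (p.1 0) (Fin.tail p.1) with hc
  split_ifs with h
  · have hexp : n - 2 * (Finset.univ.filter fun e => c e ≠ 0).card = ∑ e, (c e - 2) := by
      rw [mul_comm, ← smul_eq_mul, ← Finset.sum_const, Finset.sum_filter]
      refine Nat.sub_eq_of_eq_add ?_
      rw [← Finset.sum_add_distrib, ← hsum]
      refine Finset.sum_congr rfl fun e _ => ?_
      have := h e
      split_ifs <;> omega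
    rw [hexp]
    conv_rhs => rw [← hsum]
    rw [← Finset.prod_pow_eq_pow_sum, ← Finset.prod_pow_eq_pow_sum, ← Finset.prod_mul_distrib]
    exact Finset.prod_le_prod (fun _ _ => abs_nonneg _) fun e _ => hμ.abs_moment_le hM (h e)
  · push Not at h
    obtain ⟨e, he⟩ := h
    rw [mul_zero, Finset.prod_eq_zero (Finset.mem_univ e)]
    simp [he, hμ.mean]

theorem IsSymmetricIID.le_integral_entryProd (ha : IsSymmetricIID P μ a)
    (hμ : IsEntryLaw μ σ) {n : ℕ} (p : ClosedPath N n) (hp : p.IsEven) :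
    (1 / √N) ^ n * |σ| ^ n ≤ ∫ ω, p.entryProd (randomMatrix a ω) ∂P := by
  rw [ha.integral_entryProd]
  refine mul_le_mul_of_nonneg_left ?_ (by positivity)
  have hsum : ∑ e, p.edgeCount e = n := by
    simp_rw [p.edgeCount_eq]; exact sum_passages n _ _
  conv_lhs => rw [← hsum]
  rw [← Finset.prod_pow_eq_pow_sum]
  exact Finset.prod_le_prod (fun _ _ => by positivity) fun e _ => hμ.pow_le_moment (hp e)

theorem one_div_sqrt_pow_mul (N m : ℕ) (σ : ℝ) :
    (1 / √(N : ℝ)) ^ (2 * m) * |σ| ^ (2 * m) = (1 / (N : ℝ)) ^ m * σ ^ (2 * m) := by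
  rw [pow_mul, pow_mul |σ|, pow_mul σ, sq_abs, div_pow, Real.sq_sqrt (by positivity), one_pow]

theorem IsSymmetricIID.le_evenContribution (ha : IsSymmetricIID P μ a) (hμ : IsEntryLaw μ σ)
    (m : ℕ) (hN : 2 * m + 1 ≤ N) :
    N * catalan m * σ ^ (2 * m) * (1 - m * (2 * m + 1) / N) ≤ evenContribution P a (2 * m) := by
  classical
  have hN' : (2 * m + 1 : ℝ) ≤ N := by exact_mod_cast hN
  have hN0 : (0 : ℝ) < N := by have : (0 : ℝ) ≤ m := by positivity
                               linarith
  have hy : (0 : ℝ) ≤ N - (2 * m + 1) := by linarith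
  set κ : ℝ := (1 / √N) ^ (2 * m) * |σ| ^ (2 * m) with hκ
  have hκ0 : 0 ≤ κ := by positivity
  have hcount : N * (catalan m * (N - (2 * m + 1) : ℝ) ^ m) ≤
      ∑ p : ClosedPath N (2 * m), if p.IsEven then (1 : ℝ) else 0 := by
    have h1 : ∀ p : ClosedPath N (2 * m), (if p.IsEven then (1 : ℝ) else 0) =
        if ∀ e, Even (passages (2 * m) (p.1 0) (Fin.tail p.1) e) then 1 else 0 := by
      intro p
      simp only [ClosedPath.IsEven, p.edgeCount_eq]
    rw [Finset.sum_congr rfl fun p _ => h1 p, sum_closedPath (2 * m) fun p =>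
      if ∀ e, Even (passages (2 * m) (p 0) (Fin.tail p) e) then (1 : ℝ) else 0]
    have h2 := Finset.card_nsmul_le_sum (Finset.univ : Finset (Fin N)) _ _ fun v _ =>
      catalan_mul_le_card (Real.sqrt_nonneg (N - (2 * m + 1))) m
        (by rw [Real.sq_sqrt hy]; linarith) v
    rw [Real.sq_sqrt hy, Finset.card_univ, Fintype.card_fin, nsmul_eq_mul] at h2
    refine h2.trans (Finset.sum_le_sum fun v _ => Finset.sum_le_sum fun t _ => ?_)
    by_cases h : HasOddEdges (2 * m) v t ∅ v
    · rw [if_pos h, if_pos h.2, if_pos]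
      intro e
      have := h.1 e
      simpa using this
    · rw [if_neg h]
      split_ifs <;> norm_num
  have hsum : κ * ∑ p : ClosedPath N (2 * m), (if p.IsEven then (1 : ℝ) else 0) ≤
      evenContribution P a (2 * m) := by
    rw [← Finset.sum_filter, Finset.mul_sum, evenContribution]
    refine (Finset.sum_le_sum fun p hp => ?_).trans (le_of_eq (Finset.sum_congr ?_ fun _ _ => rfl))
    · rw [mul_one]
      exact ha.le_integral_entryProd hμ p (Finset.mem_filter.mp hp).2
    · ext p; simp
  refine le_trans ?_ ((mul_le_mul_of_nonneg_left hcount hκ0).trans hsum)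
  -- Bernoulli's inequality again.
  have hb : 1 - m * (2 * m + 1) / N ≤ (1 - (2 * m + 1) / N : ℝ) ^ m := by
    have h1 : (2 * m + 1 : ℝ) / N ≤ 1 := (div_le_one hN0).mpr hN'
    have := one_add_mul_le_pow (a := (-((2 * m + 1) / N) : ℝ)) (by linarith) m
    calc _ = 1 + m * (-((2 * m + 1) / N) : ℝ) := by ring
      _ ≤ _ := this
      _ = _ := by ring
  rw [hκ, one_div_sqrt_pow_mul]
  calc _ ≤ N * catalan m * σ ^ (2 * m) * (1 - (2 * m + 1) / N : ℝ) ^ m := by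
        refine mul_le_mul_of_nonneg_left hb ?_
        rw [pow_mul]; positivity
    _ = _ := by
        rw [show (1 - (2 * m + 1) / N : ℝ) = 1 / N * (N - (2 * m + 1)) by field_simp, mul_pow]
        ring

theorem IsSymmetricIID.sum_abs_le (ha : IsSymmetricIID P μ a) (hμ : IsEntryLaw μ σ) {R : ℝ}
    (hR : 1 ≤ R) (hM : ∀ᵐ x ∂μ, |x| ≤ R * |σ|) (m : ℕ) (hN : 0 < N)
    (hm : 16 * R * (m / √N) < 1) :
    ∑ p : ClosedPath N (2 * m), |∫ ω, p.entryProd (randomMatrix a ω) ∂P| ≤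
      N * catalan m * σ ^ (2 * m) *
        (Real.exp (m * (4 * R ^ 2 * (10 * m + 3)) / N) * (1 - 16 * R * (m / √N))⁻¹) := by
  have hN0 : (0 : ℝ) < N := by exact_mod_cast hN
  set κ : ℝ := (1 / √N) ^ (2 * m) * |σ| ^ (2 * m) with hκ
  have hκ0 : 0 ≤ κ := by positivity
  set x : ℝ := N + 4 * R ^ 2 * (10 * m + 3) with hx
  have hx0 : 0 < x := by positivity
  have hNx : √N ≤ √x := Real.sqrt_le_sqrt (le_add_of_nonneg_right (by positivity))
  have hτ : 2 * m * (8 * R / √x) ≤ 16 * R * (m / √N) := by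
    calc 2 * m * (8 * R / √x) = 16 * R * (m / √x) := by ring
      _ ≤ _ := by
        have := Real.sqrt_pos.mpr hN0
        gcongr
  have hstart : ∀ v : Fin N, WalkState.completions R (2 * m) (WalkState.start v) ≤
      x ^ m * (catalan m * (1 - 16 * R * (m / √N))⁻¹) := by
    intro v
    have h := WalkState.completions_start_le hR (Real.sqrt_pos.mpr hx0) (m := m) (N := N)
      (by rw [Real.sq_sqrt hx0.le]) (hτ.trans_lt hm) v
    rw [Real.sq_sqrt hx0.le] at h
    refine h.trans ?_
    have h1 : 0 < 1 - 16 * R * (m / √N) := by linarith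
    have h2 : (1 - 2 * m * (8 * R / √x))⁻¹ ≤ (1 - 16 * R * (m / √N))⁻¹ :=
      inv_anti₀ h1 (by linarith)
    gcongr
  calc _ ≤ ∑ p : ClosedPath N (2 * m), κ *
        (if ∀ e, passages (2 * m) (p.1 0) (Fin.tail p.1) e ≠ 1 then
        R ^ (2 * m - 2 * (Finset.univ.filter fun e =>
          passages (2 * m) (p.1 0) (Fin.tail p.1) e ≠ 0).card) else 0) :=
        Finset.sum_le_sum fun p _ => ha.abs_integral_entryProd_le hμ hM p
    _ = κ * ∑ v : Fin N, ∑ t : Fin (2 * m) → Fin N, if endpoint (2 * m) v t = v then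
        (if ∀ e, passages (2 * m) v t e ≠ 1 then
        R ^ (2 * m - 2 * (Finset.univ.filter fun e =>
          passages (2 * m) v t e ≠ 0).card) else 0) else 0 := by
        rw [← Finset.mul_sum, sum_closedPath (2 * m) fun p =>
          (if ∀ e, passages (2 * m) (p 0) (Fin.tail p) e ≠ 1 then
          R ^ (2 * m - 2 * (Finset.univ.filter fun e =>
            passages (2 * m) (p 0) (Fin.tail p) e ≠ 0).card) else 0)]
        simp only [Fin.cons_zero, Fin.tail_cons]
    _ ≤ κ * ∑ v : Fin N, x ^ m * (catalan m * (1 - 16 * R * (m / √N))⁻¹) := by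
        refine mul_le_mul_of_nonneg_left (Finset.sum_le_sum fun v _ => ?_) hκ0
        -- The closing condition is dropped; this only adds nonnegative terms.
        refine le_trans (Finset.sum_le_sum fun t _ => ?_)
          ((sum_pow_le_sum_completions hR (2 * m) v).trans (hstart v))
        have : 0 ≤ R := by linarith
        split_ifs <;> first | exact le_rfl | positivity
    _ = N * catalan m * σ ^ (2 * m) * ((x / N) ^ m * (1 - 16 * R * (m / √N))⁻¹) := by
        rw [hκ, one_div_sqrt_pow_mul]
        simp only [Finset.sum_const, Finset.card_univ, Fintype.card_fin, nsmul_eq_mul]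
        rw [div_eq_mul_one_div x, mul_pow]
        ring
    _ ≤ _ := by
        have h1 : 0 < 1 - 16 * R * (m / √N) := by linarith
        have h2 : (x / N) ^ m ≤ Real.exp (m * (4 * R ^ 2 * (10 * m + 3)) / N) := by
          rw [mul_div_assoc, Real.exp_nat_mul]
          refine pow_le_pow_left₀ (by positivity) ?_ m
          have := Real.add_one_le_exp (4 * R ^ 2 * (10 * m + 3) / N : ℝ)
          refine le_trans (le_of_eq ?_) this
          rw [hx]; field_simp; ring
        have h3 : 0 ≤ σ ^ (2 * m) := by rw [pow_mul]; positivity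
        gcongr

end Expectation

/-! ### Limits of the two error factors and the squeeze -/

theorem tendsto_lower {s : ℕ → ℕ} (h : Tendsto (fun N : ℕ => (s N : ℝ) / √N) atTop (nhds 0)) :
    Tendsto (fun N : ℕ => 1 - (s N : ℝ) * (2 * s N + 1) / N) atTop (nhds 1) := by
  have h1 : Tendsto (fun N : ℕ => 3 * ((s N : ℝ) / √N) ^ 2) atTop (nhds 0) := by
    simpa using (h.pow 2).const_mul 3
  have h2 : Tendsto (fun N : ℕ => (s N : ℝ) * (2 * s N + 1) / N) atTop (nhds 0) := by
    refine squeeze_zero (fun N => by positivity) (fun N => ?_) h1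
    have h3 : (s N : ℝ) ≤ (s N : ℝ) ^ 2 := by exact_mod_cast Nat.le_self_pow two_ne_zero _
    rw [div_pow, Real.sq_sqrt (by positivity), ← mul_div_assoc]
    refine div_le_div_of_nonneg_right ?_ (by positivity)
    nlinarith
  simpa using h2.const_sub 1

theorem tendsto_upper {s : ℕ → ℕ} (h : Tendsto (fun N : ℕ => (s N : ℝ) / √N) atTop (nhds 0))
    (R : ℝ) :
    Tendsto (fun N : ℕ => Real.exp ((s N : ℝ) * (4 * R ^ 2 * (10 * s N + 3)) / N) *
      (1 - 16 * R * ((s N : ℝ) / √N))⁻¹) atTop (nhds 1) := by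
  -- `52 = 4 * (10 + 3)`, since `s ≤ s ^ 2` for natural numbers.
  have h1 : Tendsto (fun N : ℕ => 52 * R ^ 2 * ((s N : ℝ) / √N) ^ 2) atTop (nhds 0) := by
    simpa using (h.pow 2).const_mul (52 * R ^ 2)
  have h2 : Tendsto (fun N : ℕ => (s N : ℝ) * (4 * R ^ 2 * (10 * s N + 3)) / N)
      atTop (nhds 0) := by
    refine squeeze_zero (fun N => by positivity) (fun N => ?_) h1
    have h3 : (s N : ℝ) ≤ (s N : ℝ) ^ 2 := by exact_mod_cast Nat.le_self_pow two_ne_zero _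
    rw [div_pow, Real.sq_sqrt (by positivity), ← mul_div_assoc]
    refine div_le_div_of_nonneg_right ?_ (by positivity)
    have : 0 ≤ R ^ 2 := by positivity
    nlinarith
  have h3 : Tendsto (fun N : ℕ => (1 - 16 * R * ((s N : ℝ) / √N))⁻¹) atTop (nhds 1) := by
    have : Tendsto (fun N : ℕ => 1 - 16 * R * ((s N : ℝ) / √N)) atTop (nhds 1) := by
      simpa using (h.const_mul (16 * R)).const_sub 1
    simpa using this.inv₀ one_ne_zero
  simpa using ((Real.continuous_exp.tendsto 0).comp h2).mul h3

theorem catalan_pos (m : ℕ) : 0 < catalan m := by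
  have h := succ_mul_catalan_eq_centralBinom m
  have h2 := Nat.centralBinom_pos m
  exact Nat.pos_of_ne_zero fun h0 => by rw [h0] at h; omega

end WignerTrace
end

theorem proposition3p1 {Ω : ℕ → Type*} [∀ N, MeasurableSpace (Ω N)]
    (P : ∀ N, Measure (Ω N)) [∀ N, IsProbabilityMeasure (P N)]
    (μ : Measure ℝ) [IsProbabilityMeasure μ] (σ : ℝ) (hμ : WignerTrace.IsEntryLaw μ σ)
    (a : ∀ N, Fin N → Fin N → Ω N → ℝ)
    (ha : ∀ N, WignerTrace.IsSymmetricIID (P N) μ (a N))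
    (s : ℕ → ℕ) (hs : Tendsto s atTop atTop)
    (hsN : (fun N => (s N : ℝ)) =o[atTop] (fun N => Real.sqrt (N : ℝ))) :
    -- all the expectations below are those of integrable variables
    (∀ N n, Integrable (fun ω => (WignerTrace.randomMatrix (a N) ω ^ n).trace) (P N)) ∧
    (∀ N n (p : WignerTrace.ClosedPath N n),
      Integrable (fun ω => p.entryProd (WignerTrace.randomMatrix (a N) ω)) (P N)) ∧
    (fun N => WignerTrace.expectedTrace (P N) (a N) (2 * s N)) ~[atTop]
      (fun N => WignerTrace.evenContribution (P N) (a N) (2 * s N)) ∧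
    (fun N => WignerTrace.evenContribution (P N) (a N) (2 * s N)) ~[atTop]
      (fun N => (N : ℝ) * (catalan (s N) : ℝ) * σ ^ (2 * s N)) ∧
    (fun N => WignerTrace.expectedTrace (P N) (a N) (2 * s N)) ~[atTop]
      (fun N => (N : ℝ) * (catalan (s N) : ℝ) * σ ^ (2 * s N)) ∧
    (fun N => WignerTrace.oddContribution (P N) (a N) (2 * s N)) =o[atTop]
      (fun N => WignerTrace.evenContribution (P N) (a N) (2 * s N)) := by
  classical
  obtain ⟨R, hR, hM⟩ := hμ.exists_ratio
  have hint : ∀ N n (p : WignerTrace.ClosedPath N n),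
      Integrable (fun ω => p.entryProd (WignerTrace.randomMatrix (a N) ω)) (P N) :=
    fun N n p => (ha N).integrable_entryProd hM p
  have hratio : Tendsto (fun N : ℕ => (s N : ℝ) / √N) atTop (nhds 0) := hsN.tendsto_div_nhds_zero
  set T : ℕ → ℝ := fun N => (N : ℝ) * (catalan (s N) : ℝ) * σ ^ (2 * s N) with hT
  set lo : ℕ → ℝ := fun N => 1 - (s N : ℝ) * (2 * s N + 1) / N with hlo
  set hi : ℕ → ℝ := fun N => Real.exp ((s N : ℝ) * (4 * R ^ 2 * (10 * s N + 3)) / N) *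
    (1 - 16 * R * ((s N : ℝ) / √N))⁻¹ with hhi
  set Ze : ℕ → ℝ := fun N => WignerTrace.evenContribution (P N) (a N) (2 * s N) with hZe
  set Zo : ℕ → ℝ := fun N => WignerTrace.oddContribution (P N) (a N) (2 * s N) with hZo
  have htlo : Tendsto lo atTop (nhds 1) := WignerTrace.tendsto_lower hratio
  have hthi : Tendsto hi atTop (nhds 1) := WignerTrace.tendsto_upper hratio R
  have hTpos : ∀ᶠ N in atTop, 0 < T N := by
    filter_upwards [eventually_gt_atTop 0] with N hN
    have h1 := WignerTrace.catalan_pos (s N)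
    have h2 : 0 < σ ^ 2 := by have := hμ.sigma_ne_zero; positivity
    simp only [hT, pow_mul]
    positivity
  -- The upper bound holds for `Ze + |Zo|` together, so the lower bound on `Ze` leaves `|Zo|` at
  -- most `T * (hi - lo)`.
  have hbounds : ∀ᶠ N in atTop, T N * lo N ≤ Ze N ∧ Ze N + |Zo N| ≤ T N * hi N := by
    have hsmall : ∀ᶠ N : ℕ in atTop, 16 * R * ((s N : ℝ) / √N) < 1 := by
      have : Tendsto (fun N : ℕ => 16 * R * ((s N : ℝ) / √N)) atTop (nhds 0) := by
        simpa using hratio.const_mul (16 * R)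
      exact this.eventually_lt_const one_pos
    have hpos : ∀ᶠ N in atTop, 0 < lo N := htlo.eventually_const_lt one_pos
    filter_upwards [eventually_gt_atTop 0, hsmall, hs.eventually_ge_atTop 1, hpos]
      with N hN hsm hs1 hlopos
    have hN0 : (0 : ℝ) < N := by exact_mod_cast hN
    -- Positivity of `lo N` means `s (2s + 1) < N`, and `s ≥ 1`.
    have hle : 2 * s N + 1 ≤ N := by
      have h1 : (s N : ℝ) * (2 * s N + 1) / N < 1 := by simpa [hlo] using hlopos
      rw [div_lt_one hN0] at h1
      have h2 : s N * (2 * s N + 1) < N := by exact_mod_cast h1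
      nlinarith
    refine ⟨(ha N).le_evenContribution hμ (s N) hle, ?_⟩
    refine le_trans ?_ ((ha N).sum_abs_le hμ hR hM (s N) hN hsm)
    rw [← Finset.sum_filter_add_sum_filter_not Finset.univ
      (fun p : WignerTrace.ClosedPath N (2 * s N) => p.IsEven)]
    refine add_le_add ?_ ?_
    · refine le_of_eq_of_le ?_ (Finset.sum_le_sum fun p _ => le_abs_self _)
      simp only [hZe, WignerTrace.evenContribution]
    · refine le_of_eq_of_le ?_ (Finset.abs_sum_le_sum_abs _ _)
      simp only [hZo, WignerTrace.oddContribution]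
      congr 1
      refine Finset.sum_congr ?_ fun _ _ => rfl
      ext p
      simp only [Finset.mem_filter, Finset.mem_univ, true_and, p.isOdd_iff]
  have hTne : ∀ᶠ N in atTop, T N ≠ 0 := hTpos.mono fun N h => h.ne'
  have heven : Ze ~[atTop] T := by
    rw [isEquivalent_iff_tendsto_one hTne]
    refine tendsto_of_tendsto_of_tendsto_of_le_of_le' htlo hthi ?_ ?_
    · filter_upwards [hTpos, hbounds] with N hN hb
      rw [Pi.div_apply, le_div_iff₀ hN, mul_comm]
      exact hb.1
    · filter_upwards [hTpos, hbounds] with N hN hb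
      rw [Pi.div_apply, div_le_iff₀ hN, mul_comm]
      linarith [hb.2, abs_nonneg (Zo N)]
  have hodd : Zo =o[atTop] T := by
    rw [isLittleO_iff_tendsto' (hTne.mono fun N h h0 => absurd h0 h)]
    refine squeeze_zero_norm' (a := fun N => hi N - lo N) ?_ (by simpa using hthi.sub htlo)
    filter_upwards [hTpos, hbounds] with N hN hb
    rw [Real.norm_eq_abs, abs_div, abs_of_pos hN, div_le_iff₀ hN]
    linarith [hb.1, hb.2]
  have hoe : Zo =o[atTop] Ze := hodd.trans_isBigO heven.isBigO_symm
  have hsum : (fun N => WignerTrace.expectedTrace (P N) (a N) (2 * s N)) = Ze + Zo :=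
    funext fun N => WignerTrace.expectedTrace_eq (hint N) (2 * s N)
  have htrace : (fun N => WignerTrace.expectedTrace (P N) (a N) (2 * s N)) ~[atTop] Ze := by
    rw [hsum]
    exact IsEquivalent.refl.add_isLittleO hoe
  refine ⟨fun N n => ?_, hint, htrace, heven, htrace.trans heven, hoe⟩
  simp_rw [WignerTrace.trace_pow_eq_sum]
  exact integrable_finsetSum _ fun p _ => hint N n p
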